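/- Let $\Gamma$ be a countable discrete group, and let $\sigma:\Gamma\times\Gamma\to\mathbb{R}$ be a normalized $2$-cocycle, i.e. $\sigma(a,b)+\sigma(ab,c)=\sigma(a,bc)+\sigma(b,c)$ and $\sigma(a,e)=\sigma(e,a)=0$ for all $a,b,c\in\Gamma$, whose class in $H^2(\Gamma,\mathbb{R})$ (trivial action) is nonzero. For $\theta\in\mathbb{R}$ let $\sigma_\theta(s,t)=e^{2\pi i\theta\sigma(s,t)}$, and let $C^*(\Gamma,\sigma_\theta)$ be the twisted full group $C^*$-algebra, i.e. the completion, in the largest $C^*$-seminorm, of the $*$-algebra of finitely supported functions on $\Gamma$ with product $\delta_s\delta_t=\sigma_\theta(s,t)\,\delta_{st}$ and with every $\delta_s$ unitary. A $C^*$-algebra is called MF if it is separable and embeds in $\prod_i M_{k(i)}(\mathbb{C})/\bigoplus_i M_{k(i)}(\mathbb{C})$ for some sequence $(k(i))_{i\in\mathbb{N}}$ of positive integers. Suppose that there is a decreasing sequence $(\theta_n)$ of positive real numbers with $\theta_n\to0$ such that, for every $n$, $C^*(\Gamma,\sigma_{\theta_n})$ has a nonzero quotient $C^*$-algebra that is MF.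 Then $\Gamma$ is not matricially stable. That is, it is not true that for every sequence of integers $k_n\ge1$ and of maps $\rho_n:\Gamma\to U(k_n)$ with $\rho_n(e)=1$ and $\lim_n\|\rho_n(st)-\rho_n(s)\rho_n(t)\|=0$ for all $s,t\in\Gamma$ (operator norm), there are group homomorphisms $\pi_n:\Gamma\to U(k_n)$ with $\lim_n\|\rho_n(s)-\pi_n(s)\|=0$ for all $s\in\Gamma$. -/

import Mathlib

open Filter Topology
open scoped ENNReal ComplexConjugate Matrix.Norms.L2Operator

noncomputable section

/-! ### Second cohomology of a group with trivial coefficients -/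

section Cohomology

/-- The group `Z²(Γ, Q)` of `2`-cocycles with values in the trivial `Γ`-module `Q`: functions with
`σ(a, b) + σ(ab, c) = σ(a, bc) + σ(b, c)`. -/
def twoCocycles (Γ Q : Type*) [Group Γ] [AddCommGroup Q] : AddSubgroup (Γ → Γ → Q) where
  carrier := {σ | ∀ a b c, σ a b + σ (a * b) c = σ a (b * c) + σ b c}
  add_mem' {σ τ} hσ hτ a b c := by
    have h := congrArg₂ (· + ·) (hσ a b c) (hτ a b c)
    simp only [Pi.add_apply] at h ⊢
    rw [add_add_add_comm, h, add_add_add_comm]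
  zero_mem' a b c := by simp
  neg_mem' {σ} hσ a b c := by
    have h := congrArg Neg.neg (hσ a b c)
    simp only [Pi.neg_apply] at h ⊢
    rw [← neg_add, h, neg_add]

/-- The subgroup `B²(Γ, Q)` of `2`-coboundaries: the cocycles `(a, b) ↦ γ(a) - γ(ab) + γ(b)` for
some function `γ : Γ → Q`. -/
def twoCoboundaries (Γ Q : Type*) [Group Γ] [AddCommGroup Q] :
    AddSubgroup (twoCocycles Γ Q) where
  carrier := {σ | ∃ γ : Γ → Q, ∀ a b, σ.1 a b = γ a - γ (a * b) + γ b}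
  add_mem' := by
    rintro σ τ ⟨γ, hγ⟩ ⟨δ, hδ⟩
    refine ⟨γ + δ, fun a b => ?_⟩
    simp only [AddSubgroup.coe_add, Pi.add_apply, hγ, hδ]
    abel
  zero_mem' := ⟨0, fun a b => by simp⟩
  neg_mem' := by
    rintro σ ⟨γ, hγ⟩
    refine ⟨-γ, fun a b => ?_⟩
    simp only [AddSubgroup.coe_neg, Pi.neg_apply, hγ]
    abel

/-- The second cohomology group `H²(Γ, Q) = Z²(Γ, Q) / B²(Γ, Q)`. -/
abbrev SecondCohomology (Γ Q : Type*) [Group Γ] [AddCommGroup Q] : Type _ :=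
  twoCocycles Γ Q ⧸ twoCoboundaries Γ Q

/-- The class `[σ] ∈ H²(Γ, Q)` of a cocycle `σ`. -/
def SecondCohomology.mk {Γ Q : Type*} [Group Γ] [AddCommGroup Q] (σ : twoCocycles Γ Q) :
    SecondCohomology Γ Q :=
  QuotientAddGroup.mk σ

/-- A cocycle is normalized if `σ(a, e) = σ(e, a) = 0` for all `a`. -/
def IsNormalizedCocycle {Γ Q : Type*} [Group Γ] [AddCommGroup Q] (σ : twoCocycles Γ Q) : Prop :=
  ∀ a, σ.1 a 1 = 0 ∧ σ.1 1 a = 0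

/-- A normalized `2`-cocycle on `Γ` with values in the circle group `𝕋`, written
multiplicatively. -/
structure CircleCocycle (Γ : Type*) [Group Γ] where
  /-- The underlying function. -/
  toFun : Γ → Γ → Circle
  cocycle : ∀ a b c, toFun a b * toFun (a * b) c = toFun a (b * c) * toFun b c
  map_one_right : ∀ a, toFun a 1 = 1
  map_one_left : ∀ a, toFun 1 a = 1

/-- The `𝕋`-valued cocycle `σ_θ(s, t) = exp(2πiθσ(s, t))` attached to a normalized real-valued
cocycle `σ` and a real number `θ`. -/
def expCocycle {Γ : Type*} [Group Γ] (σ : twoCocycles Γ ℝ) (hσ : IsNormalizedCocycle σ) (θ : ℝ) :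
    CircleCocycle Γ where
  toFun s t := Circle.exp (2 * Real.pi * θ * σ.1 s t)
  cocycle a b c := by
    rw [← Circle.exp_add, ← Circle.exp_add, ← mul_add, ← mul_add, σ.2 a b c]
  map_one_right a := by rw [(hσ a).1, mul_zero, Circle.exp_zero]
  map_one_left a := by rw [(hσ a).2, mul_zero, Circle.exp_zero]

end Cohomology

/-! ### The twisted group `*`-algebra -/

section TwistedAlgebra

/-- The twisted group algebra `ℂ[Γ, ω]`: finitely supported functions on `Γ`, the function with
value `a` at `s` and `0` elsewhere being written `a δ_s`. -/
def TwistedGroupAlgebra {Γ : Type*} [Group Γ] (_ω : CircleCocycle Γ) : Type _ := Γ →₀ ℂ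

namespace TwistedGroupAlgebra

variable {Γ : Type*} [Group Γ] {ω : CircleCocycle Γ}

instance : AddCommGroup (TwistedGroupAlgebra ω) := inferInstanceAs (AddCommGroup (Γ →₀ ℂ))

instance : Module ℂ (TwistedGroupAlgebra ω) := inferInstanceAs (Module ℂ (Γ →₀ ℂ))

/-- The element `a δ_s`. -/
def single (ω : CircleCocycle Γ) (s : Γ) (a : ℂ) : TwistedGroupAlgebra ω := Finsupp.single s a

theorem single_add (s : Γ) (a b : ℂ) : single ω s (a + b) = single ω s a + single ω s b :=
  Finsupp.single_add s a b

theorem single_zero (s : Γ) : single ω s 0 = 0 := Finsupp.single_zero s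

theorem smul_single (c : ℂ) (s : Γ) (a : ℂ) : c • single ω s a = single ω s (c * a) :=
  Finsupp.smul_single' c s a

theorem induction {P : TwistedGroupAlgebra ω → Prop} (f : TwistedGroupAlgebra ω)
    (h0 : P 0) (hs : ∀ s a, P (single ω s a)) (ha : ∀ f g, P f → P g → P (f + g)) : P f :=
  Finsupp.induction_linear (motive := P) f h0 ha hs

/-- Twisted convolution, `(a δ_s)(b δ_t) = a b ω(s, t) δ_{st}` extended bilinearly. -/
def twistedMul (ω : CircleCocycle Γ) (f g : Γ →₀ ℂ) : Γ →₀ ℂ :=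
  f.sum fun s a => g.sum fun t b => Finsupp.single (s * t) (a * b * (ω.toFun s t : ℂ))

instance : Mul (TwistedGroupAlgebra ω) := ⟨fun f g => twistedMul ω f g⟩

theorem single_mul_single (s t : Γ) (a b : ℂ) :
    single ω s a * single ω t b = single ω (s * t) (a * b * (ω.toFun s t : ℂ)) := by
  change twistedMul ω (Finsupp.single s a) (Finsupp.single t b) = Finsupp.single _ _
  unfold twistedMul
  rw [Finsupp.sum_single_index, Finsupp.sum_single_index] <;> simp

instance : One (TwistedGroupAlgebra ω) := ⟨single ω 1 1⟩

theorem one_def : (1 : TwistedGroupAlgebra ω) = single ω 1 1 := rfl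

theorem twistedMul_add (f g h : Γ →₀ ℂ) :
    twistedMul ω f (g + h) = twistedMul ω f g + twistedMul ω f h := by
  unfold twistedMul
  rw [← Finsupp.sum_add]
  refine Finsupp.sum_congr fun s _ => Finsupp.sum_add_index' (by simp) fun t b c => ?_
  rw [← Finsupp.single_add]
  congr 1
  ring

theorem add_twistedMul (f g h : Γ →₀ ℂ) :
    twistedMul ω (f + g) h = twistedMul ω f h + twistedMul ω g h := by
  unfold twistedMul
  refine Finsupp.sum_add_index' (fun s => by simp [Finsupp.sum]) fun s b c => ?_
  rw [← Finsupp.sum_add]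
  refine Finsupp.sum_congr fun t _ => ?_
  rw [← Finsupp.single_add]
  congr 1
  ring

protected theorem mul_add' (f g h : TwistedGroupAlgebra ω) : f * (g + h) = f * g + f * h :=
  twistedMul_add f g h

protected theorem add_mul' (f g h : TwistedGroupAlgebra ω) : (f + g) * h = f * h + g * h :=
  add_twistedMul f g h

protected theorem zero_mul' (f : TwistedGroupAlgebra ω) : 0 * f = 0 := by
  simpa using TwistedGroupAlgebra.add_mul' 0 0 f

protected theorem mul_zero' (f : TwistedGroupAlgebra ω) : f * 0 = 0 := by
  simpa using TwistedGroupAlgebra.mul_add' f 0 0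

protected theorem mul_assoc' (f g h : TwistedGroupAlgebra ω) : f * g * h = f * (g * h) := by
  induction f using induction with
  | h0 => simp only [TwistedGroupAlgebra.zero_mul']
  | ha f₁ f₂ h₁ h₂ => simp only [TwistedGroupAlgebra.add_mul', h₁, h₂]
  | hs s a =>
  induction g using induction with
  | h0 => simp only [TwistedGroupAlgebra.zero_mul', TwistedGroupAlgebra.mul_zero']
  | ha f₁ f₂ h₁ h₂ =>
    simp only [TwistedGroupAlgebra.add_mul', TwistedGroupAlgebra.mul_add', h₁, h₂]
  | hs t b =>
  induction h using induction with
  | h0 => simp only [TwistedGroupAlgebra.mul_zero']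
  | ha f₁ f₂ h₁ h₂ => simp only [TwistedGroupAlgebra.mul_add', h₁, h₂]
  | hs r c =>
    have h : ((ω.toFun s t : ℂ) : ℂ) * (ω.toFun (s * t) r : Circle) =
        (ω.toFun s (t * r) : Circle) * (ω.toFun t r : Circle) := by
      exact_mod_cast congrArg (Subtype.val) (ω.cocycle s t r)
    simp only [single_mul_single, mul_assoc]
    congr 2
    linear_combination b * c * h

protected theorem one_mul' (f : TwistedGroupAlgebra ω) : 1 * f = f := by
  induction f using induction with
  | h0 => exact TwistedGroupAlgebra.mul_zero' _
  | ha f₁ f₂ h₁ h₂ => rw [TwistedGroupAlgebra.mul_add', h₁, h₂]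
  | hs s a => simp [one_def, single_mul_single, ω.map_one_left]

protected theorem mul_one' (f : TwistedGroupAlgebra ω) : f * 1 = f := by
  induction f using induction with
  | h0 => exact TwistedGroupAlgebra.zero_mul' _
  | ha f₁ f₂ h₁ h₂ => rw [TwistedGroupAlgebra.add_mul', h₁, h₂]
  | hs s a => simp [one_def, single_mul_single, ω.map_one_right]

instance : Ring (TwistedGroupAlgebra ω) where
  left_distrib := TwistedGroupAlgebra.mul_add'
  right_distrib := TwistedGroupAlgebra.add_mul'
  zero_mul := TwistedGroupAlgebra.zero_mul'
  mul_zero := TwistedGroupAlgebra.mul_zero'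
  mul_assoc := TwistedGroupAlgebra.mul_assoc'
  one_mul := TwistedGroupAlgebra.one_mul'
  mul_one := TwistedGroupAlgebra.mul_one'
  neg_add_cancel := neg_add_cancel
  sub_eq_add_neg := sub_eq_add_neg
  zsmul := fun n f => n • f
  zsmul_zero' := SubNegMonoid.zsmul_zero'
  zsmul_succ' := SubNegMonoid.zsmul_succ'
  zsmul_neg' := SubNegMonoid.zsmul_neg'

instance : Algebra ℂ (TwistedGroupAlgebra ω) :=
  Algebra.ofModule
    (fun c f g => by
      induction f using induction with
      | h0 => simp
      | ha f₁ f₂ h₁ h₂ => simp only [smul_add, add_mul, h₁, h₂]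
      | hs s a =>
      induction g using induction with
      | h0 => simp
      | ha f₁ f₂ h₁ h₂ => simp only [smul_add, mul_add, h₁, h₂]
      | hs t b => simp only [smul_single, single_mul_single, mul_assoc])
    (fun c f g => by
      induction f using induction with
      | h0 => simp
      | ha f₁ f₂ h₁ h₂ => simp only [smul_add, add_mul, h₁, h₂]
      | hs s a =>
      induction g using induction with
      | h0 => simp
      | ha f₁ f₂ h₁ h₂ => simp only [smul_add, mul_add, h₁, h₂]
      | hs t b => simp only [smul_single, single_mul_single, mul_assoc, mul_left_comm c])

/-- The involution, `(a δ_s)* = conj(a ω(s⁻¹, s)) δ_{s⁻¹}` extended additively; it makes every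
`δ_s` unitary. -/
def twistedStar (ω : CircleCocycle Γ) (f : Γ →₀ ℂ) : Γ →₀ ℂ :=
  f.sum fun s a => Finsupp.single s⁻¹ (conj (a * (ω.toFun s⁻¹ s : ℂ)))

instance : Star (TwistedGroupAlgebra ω) := ⟨fun f => twistedStar ω f⟩

theorem star_single (s : Γ) (a : ℂ) :
    star (single ω s a) = single ω s⁻¹ (conj (a * (ω.toFun s⁻¹ s : ℂ))) := by
  change twistedStar ω (Finsupp.single s a) = Finsupp.single _ _
  unfold twistedStar
  rw [Finsupp.sum_single_index]
  simp

theorem twistedStar_add (f g : Γ →₀ ℂ) :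
    twistedStar ω (f + g) = twistedStar ω f + twistedStar ω g := by
  unfold twistedStar
  refine Finsupp.sum_add_index' (by simp) fun s b c => ?_
  rw [← Finsupp.single_add, add_mul, map_add]

protected theorem star_add' (f g : TwistedGroupAlgebra ω) : star (f + g) = star f + star g :=
  twistedStar_add f g

protected theorem star_zero' : star (0 : TwistedGroupAlgebra ω) = 0 := by
  simpa using TwistedGroupAlgebra.star_add' (0 : TwistedGroupAlgebra ω) 0

theorem _root_.CircleCocycle.inv_symm (ω : CircleCocycle Γ) (s : Γ) :
    ω.toFun s⁻¹ s = ω.toFun s s⁻¹ := by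
  have h := ω.cocycle s s⁻¹ s
  simpa [ω.map_one_left, ω.map_one_right] using h.symm

theorem circle_mul_conj (z : Circle) : (z : ℂ) * conj (z : ℂ) = 1 := by
  rw [Complex.mul_conj, Circle.normSq_coe, Complex.ofReal_one]

protected theorem star_star' (f : TwistedGroupAlgebra ω) : star (star f) = f := by
  induction f using induction with
  | h0 => simp only [TwistedGroupAlgebra.star_zero']
  | ha f₁ f₂ h₁ h₂ => simp only [TwistedGroupAlgebra.star_add', h₁, h₂]
  | hs s a =>
    rw [star_single, star_single, inv_inv, ω.inv_symm s]
    congr 1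
    simp only [map_mul, Complex.conj_conj]
    rw [mul_assoc, circle_mul_conj, mul_one]

protected theorem star_mul' (f g : TwistedGroupAlgebra ω) : star (f * g) = star g * star f := by
  induction f using induction with
  | h0 => simp only [TwistedGroupAlgebra.star_zero', zero_mul, mul_zero]
  | ha f₁ f₂ h₁ h₂ => simp only [TwistedGroupAlgebra.star_add', h₁, h₂, add_mul, mul_add]
  | hs s a =>
  induction g using induction with
  | h0 => simp only [TwistedGroupAlgebra.star_zero', zero_mul, mul_zero]
  | ha f₁ f₂ h₁ h₂ => simp only [TwistedGroupAlgebra.star_add', h₁, h₂, add_mul, mul_add]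
  | hs t b =>
    simp only [star_single, single_mul_single, mul_inv_rev]
    congr 1
    -- the cocycle identities behind `(δ_s δ_t)* = δ_t* δ_s*`
    have h1 := ω.cocycle (t⁻¹ * s⁻¹) s t
    have h2 := ω.cocycle t⁻¹ s⁻¹ s
    rw [inv_mul_cancel_right] at h1
    rw [inv_mul_cancel, ω.map_one_right, one_mul] at h2
    -- `w = ω(t⁻¹, s⁻¹)`
    have h3 : ω.toFun t⁻¹ s⁻¹ * (ω.toFun (t⁻¹ * s⁻¹) (s * t) * ω.toFun s t) =
        ω.toFun s⁻¹ s * ω.toFun t⁻¹ t := by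
      rw [← h1, ← mul_assoc, h2]
    have h4 : ((ω.toFun t⁻¹ s⁻¹ : Circle) : ℂ) *
        ((ω.toFun (t⁻¹ * s⁻¹) (s * t) : Circle) * (ω.toFun s t : ℂ)) =
        (ω.toFun s⁻¹ s : Circle) * (ω.toFun t⁻¹ t : Circle) := by
      exact_mod_cast congrArg Subtype.val h3
    have h5 := congrArg conj h4
    have h6 := circle_mul_conj (ω.toFun t⁻¹ s⁻¹)
    simp only [map_mul] at h5 ⊢
    linear_combination (-conj a * conj b * conj ((ω.toFun (t⁻¹ * s⁻¹) (s * t) : Circle) : ℂ) *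
      conj ((ω.toFun s t : ℂ) : ℂ)) * h6 +
      conj a * conj b * ((ω.toFun t⁻¹ s⁻¹ : Circle) : ℂ) * h5

instance : StarRing (TwistedGroupAlgebra ω) where
  star_involutive := TwistedGroupAlgebra.star_star'
  star_mul := TwistedGroupAlgebra.star_mul'
  star_add := TwistedGroupAlgebra.star_add'

instance : StarModule ℂ (TwistedGroupAlgebra ω) where
  star_smul c f := by
    induction f using induction with
    | h0 => simp
    | ha f₁ f₂ h₁ h₂ => simp only [smul_add, star_add, h₁, h₂]
    | hs s a =>
      simp only [smul_single, star_single]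
      congr 1
      simp [mul_assoc]

theorem star_single_mul_single (s : Γ) :
    star (single ω s 1) * single ω s 1 = 1 := by
  rw [star_single, single_mul_single, one_def, inv_mul_cancel]
  congr 1
  rw [one_mul, mul_one, mul_comm, circle_mul_conj]

end TwistedGroupAlgebra

end TwistedAlgebra

/-! ### The twisted full group `C*`-algebra -/

section CStar

/-- A `C*`-seminorm on a complex `*`-algebra: a submultiplicative seminorm with
`p(a* a) = p(a)²`. -/
structure IsCStarSeminorm {A : Type*} [Ring A] [Algebra ℂ A] [StarRing A] (p : Seminorm ℂ A) :
    Prop where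
  mul_le : ∀ a b, p (a * b) ≤ p a * p b
  star_mul_self : ∀ a, p (star a * a) = p a ^ 2

namespace IsCStarSeminorm

variable {A : Type*} [Ring A] [Algebra ℂ A] [StarRing A]

theorem zero : IsCStarSeminorm (0 : Seminorm ℂ A) := ⟨by simp, by simp⟩

theorem map_one_le {p : Seminorm ℂ A} (hp : IsCStarSeminorm p) : p 1 ≤ 1 := by
  have h := hp.star_mul_self 1
  rw [star_one, one_mul] at h
  nlinarith [apply_nonneg p 1]

theorem le_star {p : Seminorm ℂ A} (hp : IsCStarSeminorm p) (a : A) : p a ≤ p (star a) := by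
  have h := hp.star_mul_self a
  have h' := hp.mul_le (star a) a
  by_contra! hlt
  nlinarith [apply_nonneg p (star a)]

theorem map_star {p : Seminorm ℂ A} (hp : IsCStarSeminorm p) (a : A) : p (star a) = p a :=
  le_antisymm (by simpa using hp.le_star (star a)) (hp.le_star a)

end IsCStarSeminorm

namespace TwistedGroupAlgebra

variable {Γ : Type*} [Group Γ] {ω : CircleCocycle Γ}

/-- Every `C*`-seminorm on `ℂ[Γ, ω]` is dominated by the `ℓ¹`-norm. -/
theorem seminorm_le (p : Seminorm ℂ (TwistedGroupAlgebra ω)) (hp : IsCStarSeminorm p)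
    (f : TwistedGroupAlgebra ω) : p f ≤ Finsupp.sum (M := ℂ) f fun _ a => ‖a‖ := by
  have key : ∀ s a, p (single ω s a) ≤ ‖a‖ := fun s a => by
    have h1 : p (single ω s 1) ≤ 1 := by
      have h := hp.star_mul_self (single ω s 1)
      rw [star_single_mul_single] at h
      have := hp.map_one_le
      nlinarith [apply_nonneg p (single ω s 1)]
    have h2 : single ω s a = a • single ω s 1 := by rw [smul_single, mul_one]
    rw [h2, map_smul_eq_mul]
    exact mul_le_of_le_one_right (norm_nonneg a) h1
  have hsum : f = ∑ s ∈ Finsupp.support (M := ℂ) f, single ω s (f.toFun s) :=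
    (Finsupp.sum_single (M := ℂ) f).symm
  calc p f = p (∑ s ∈ Finsupp.support (M := ℂ) f, single ω s (f.toFun s)) := by rw [← hsum]
    _ ≤ ∑ s ∈ Finsupp.support (M := ℂ) f, p (single ω s (f.toFun s)) :=
        Finset.le_sum_of_subadditive p (map_zero p).le (map_add_le_add p) _ _
    _ ≤ _ := Finset.sum_le_sum fun s _ => key s _

/-- The universal norm on `ℂ[Γ, ω]`: the largest `C*`-seminorm. -/
def maxNorm (f : TwistedGroupAlgebra ω) : ℝ :=
  ⨆ p : {p : Seminorm ℂ (TwistedGroupAlgebra ω) // IsCStarSeminorm p}, p.1 f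

theorem bddAbove_seminorms (f : TwistedGroupAlgebra ω) :
    BddAbove (Set.range fun p : {p : Seminorm ℂ (TwistedGroupAlgebra ω) // IsCStarSeminorm p} =>
      p.1 f) :=
  ⟨_, by rintro _ ⟨p, rfl⟩; exact seminorm_le p.1 p.2 f⟩

instance : Nonempty {p : Seminorm ℂ (TwistedGroupAlgebra ω) // IsCStarSeminorm p} :=
  ⟨⟨0, IsCStarSeminorm.zero⟩⟩

theorem le_maxNorm {p : Seminorm ℂ (TwistedGroupAlgebra ω)} (hp : IsCStarSeminorm p)
    (f : TwistedGroupAlgebra ω) : p f ≤ maxNorm f :=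
  le_ciSup (bddAbove_seminorms f) ⟨p, hp⟩

theorem maxNorm_nonneg (f : TwistedGroupAlgebra ω) : 0 ≤ maxNorm f :=
  le_maxNorm IsCStarSeminorm.zero f

/-- The universal norm as a seminorm. -/
def maxSeminorm (ω : CircleCocycle Γ) : Seminorm ℂ (TwistedGroupAlgebra ω) :=
  Seminorm.of maxNorm
    (fun f g => ciSup_le fun p => (map_add_le_add p.1 f g).trans
      (add_le_add (le_maxNorm p.2 f) (le_maxNorm p.2 g)))
    (fun c f => by
      unfold maxNorm
      rw [Real.mul_iSup_of_nonneg (norm_nonneg c)]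
      exact iSup_congr fun p => map_smul_eq_mul p.1 c f)

theorem isCStarSeminorm_maxSeminorm (ω : CircleCocycle Γ) :
    IsCStarSeminorm (maxSeminorm ω) where
  mul_le f g := ciSup_le fun p => (p.2.mul_le f g).trans
    (mul_le_mul (le_maxNorm p.2 f) (le_maxNorm p.2 g) (apply_nonneg _ _) (maxNorm_nonneg f))
  star_mul_self f := by
    change maxNorm (star f * f) = maxNorm f ^ 2
    apply le_antisymm
    · refine ciSup_le fun p => ?_
      rw [p.2.star_mul_self]
      exact pow_le_pow_left₀ (apply_nonneg _ _) (le_maxNorm p.2 f) 2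
    · have h : maxNorm f ≤ √(maxNorm (star f * f)) := ciSup_le fun p =>
        Real.le_sqrt_of_sq_le (by rw [← p.2.star_mul_self]; exact le_maxNorm p.2 _)
      calc maxNorm f ^ 2 ≤ √(maxNorm (star f * f)) ^ 2 :=
            pow_le_pow_left₀ (maxNorm_nonneg f) h 2
        _ = _ := Real.sq_sqrt (maxNorm_nonneg _)

instance : SeminormedRing (TwistedGroupAlgebra ω) :=
  { (maxSeminorm ω).toAddGroupSeminorm.toSeminormedAddCommGroup,
    (inferInstance : Ring (TwistedGroupAlgebra ω)) with
    norm_mul_le := (isCStarSeminorm_maxSeminorm ω).mul_le }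

theorem norm_def (f : TwistedGroupAlgebra ω) : ‖f‖ = maxNorm f := rfl

instance : NormedAlgebra ℂ (TwistedGroupAlgebra ω) where
  norm_smul_le c f := (map_smul_eq_mul (maxSeminorm ω) c f).le

instance : NormedStarGroup (TwistedGroupAlgebra ω) where
  norm_star_le f := ((isCStarSeminorm_maxSeminorm ω).map_star f).le

theorem norm_star_mul_self' (f : TwistedGroupAlgebra ω) : ‖star f * f‖ = ‖f‖ ^ 2 :=
  (isCStarSeminorm_maxSeminorm ω).star_mul_self f

end TwistedGroupAlgebra

/-- The twisted full group `C*`-algebra `C*(Γ, ω)`: the (Hausdorff) completion of `ℂ[Γ, ω]` in the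
largest `C*`-seminorm. -/
def TwistedGroupCStarAlgebra {Γ : Type*} [Group Γ] (ω : CircleCocycle Γ) : Type _ :=
  UniformSpace.Completion (TwistedGroupAlgebra ω)

namespace TwistedGroupCStarAlgebra

open UniformSpace

variable {Γ : Type*} [Group Γ] {ω : CircleCocycle Γ}

instance : NormedRing (TwistedGroupCStarAlgebra ω) :=
  inferInstanceAs (NormedRing (Completion (TwistedGroupAlgebra ω)))

instance : CompleteSpace (TwistedGroupCStarAlgebra ω) :=
  inferInstanceAs (CompleteSpace (Completion (TwistedGroupAlgebra ω)))

instance : Algebra ℂ (TwistedGroupCStarAlgebra ω) :=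
  inferInstanceAs (Algebra ℂ (Completion (TwistedGroupAlgebra ω)))

instance : NormedAlgebra ℂ (TwistedGroupCStarAlgebra ω) where
  norm_smul_le := norm_smul_le (α := ℂ) (β := Completion (TwistedGroupAlgebra ω))

/-- The canonical map `ℂ[Γ, ω] → C*(Γ, ω)`. -/
def of (ω : CircleCocycle Γ) (f : TwistedGroupAlgebra ω) : TwistedGroupCStarAlgebra ω :=
  ((f : Completion (TwistedGroupAlgebra ω)))

instance : Star (TwistedGroupCStarAlgebra ω) :=
  ⟨Completion.map (star : TwistedGroupAlgebra ω → TwistedGroupAlgebra ω)⟩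

theorem uniformContinuous_star :
    UniformContinuous (star : TwistedGroupAlgebra ω → TwistedGroupAlgebra ω) :=
  (starNormedAddGroupHom : NormedAddGroupHom (TwistedGroupAlgebra ω) _).uniformContinuous

theorem star_of (f : TwistedGroupAlgebra ω) : star (of ω f) = of ω (star f) :=
  Completion.map_coe uniformContinuous_star f

theorem continuous_star' : Continuous (star : TwistedGroupCStarAlgebra ω → _) :=
  Completion.continuous_map

theorem dense_induction {P : TwistedGroupCStarAlgebra ω → Prop} (x : TwistedGroupCStarAlgebra ω)
    (hc : IsClosed {x | P x}) (h : ∀ f, P (of ω f)) : P x :=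
  Completion.induction_on (α := TwistedGroupAlgebra ω) x hc h

theorem of_mul (f g : TwistedGroupAlgebra ω) : of ω (f * g) = of ω f * of ω g :=
  Completion.coe_mul f g

theorem of_add (f g : TwistedGroupAlgebra ω) : of ω (f + g) = of ω f + of ω g :=
  Completion.coe_add f g

theorem of_smul (c : ℂ) (f : TwistedGroupAlgebra ω) : of ω (c • f) = c • of ω f :=
  Completion.coe_smul c f

theorem norm_of (f : TwistedGroupAlgebra ω) : ‖of ω f‖ = ‖f‖ := Completion.norm_coe f

instance : StarRing (TwistedGroupCStarAlgebra ω) where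
  star_involutive x := by
    refine dense_induction (P := fun x => star (star x) = x) x
      (isClosed_eq (continuous_star'.comp continuous_star') continuous_id) fun f => ?_
    rw [star_of, star_of, star_star]
  star_mul x y := by
    refine dense_induction (P := fun x => star (x * y) = star y * star x) x
      (isClosed_eq (continuous_star'.comp (continuous_mul_const y))
      ((continuous_const_mul (star y)).comp continuous_star')) fun f => ?_
    refine dense_induction (P := fun y => star (of ω f * y) = star y * star (of ω f)) y
      (isClosed_eq (continuous_star'.comp (continuous_const_mul _))
      ((continuous_mul_const _).comp continuous_star')) fun g => ?_
    rw [← of_mul, star_of, star_mul, of_mul, star_of, star_of]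
  star_add x y := by
    refine dense_induction (P := fun x => star (x + y) = star x + star y) x
      (isClosed_eq (continuous_star'.comp (continuous_add_const y))
      ((continuous_add_const (star y)).comp continuous_star')) fun f => ?_
    refine dense_induction (P := fun y => star (of ω f + y) = star (of ω f) + star y) y
      (isClosed_eq (continuous_star'.comp (continuous_const_add _))
      ((continuous_const_add _).comp continuous_star')) fun g => ?_
    rw [← of_add, star_of, star_add, of_add, star_of, star_of]

instance : StarModule ℂ (TwistedGroupCStarAlgebra ω) where
  star_smul c x := by
    refine dense_induction (P := fun x => star (c • x) = star c • star x) x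
      (isClosed_eq (continuous_star'.comp (continuous_const_smul c))
      (continuous_star'.const_smul (star c))) fun f => ?_
    rw [← of_smul, star_of, star_smul, of_smul, star_of]

instance : CStarRing (TwistedGroupCStarAlgebra ω) where
  norm_mul_self_le x := by
    refine dense_induction (P := fun x => ‖x‖ * ‖x‖ ≤ ‖star x * x‖) x
      (isClosed_le (continuous_norm.mul continuous_norm)
      (continuous_norm.comp (continuous_star'.mul continuous_id))) fun f => ?_
    rw [star_of, ← of_mul, norm_of, norm_of, TwistedGroupAlgebra.norm_star_mul_self', sq]

instance : CStarAlgebra (TwistedGroupCStarAlgebra ω) where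

end TwistedGroupCStarAlgebra

end CStar

/-! ### MF algebras -/

section MF

/-- The `C*`-algebra `∏ᵢ M_{k(i)}(ℂ)` of bounded sequences of matrices. -/
abbrev MatrixProduct (k : ℕ → ℕ+) : Type :=
  lp (fun i => Matrix (Fin (k i)) (Fin (k i)) ℂ) ∞

/-- Congruence modulo the ideal `⨁ᵢ M_{k(i)}(ℂ)` of norm-null sequences. -/
def nullSequenceCon (k : ℕ → ℕ+) : RingCon (MatrixProduct k) where
  r x y := Tendsto (fun i => ‖x i - y i‖) atTop (𝓝 0)
  iseqv :=
    { refl := fun x => by simp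
      symm := fun {x y} h => by simpa only [norm_sub_rev] using h
      trans := fun {x y z} h h' => by
        refine squeeze_zero (fun i => norm_nonneg _) (fun i => ?_) (by simpa using h.add h')
        exact norm_sub_le_norm_sub_add_norm_sub _ _ _ }
  add' {w x y z} h h' := by
    refine squeeze_zero (fun i => norm_nonneg _) (fun i => ?_) (by simpa using h.add h')
    simp only [lp.coeFn_add, Pi.add_apply, add_sub_add_comm]
    exact norm_add_le _ _
  mul' {w x y z} h h' := by
    refine squeeze_zero (g := fun i => ‖w‖ * ‖y i - z i‖ + ‖w i - x i‖ * ‖z‖)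
      (fun i => norm_nonneg _) (fun i => ?_)
      (by simpa using (h'.const_mul ‖w‖).add (h.mul_const ‖z‖))
    have e : (w * y) i - (x * z) i = w i * (y i - z i) + (w i - x i) * z i := by
      simp only [lp.infty_coeFn_mul, Pi.mul_apply]
      noncomm_ring
    rw [e]
    refine (norm_add_le _ _).trans (add_le_add ?_ ?_)
    · exact (norm_mul_le _ _).trans
        (mul_le_mul_of_nonneg_right (lp.norm_apply_le_norm ENNReal.top_ne_zero w i) (norm_nonneg _))
    · exact (norm_mul_le _ _).trans
        (mul_le_mul_of_nonneg_left (lp.norm_apply_le_norm ENNReal.top_ne_zero z i) (norm_nonneg _))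

/-- The corona `∏ᵢ M_{k(i)}(ℂ) / ⨁ᵢ M_{k(i)}(ℂ)`, as a unital complex `*`-algebra. Its quotient norm is
not recorded, since it plays no role for injective `*`-homomorphisms out of a `C*`-algebra. -/
abbrev MatrixCorona (k : ℕ → ℕ+) : Type := (nullSequenceCon k).Quotient

instance (k : ℕ → ℕ+) : StarRing (MatrixCorona k) where
  star := Quotient.map star fun x y (h : Tendsto _ _ _) => by
    change Tendsto (fun i => ‖star x i - star y i‖) atTop (𝓝 0)
    refine h.congr fun i => ?_
    rw [lp.star_apply, lp.star_apply, ← star_sub, norm_star]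
  star_involutive := Quotient.ind fun x => congrArg (Quotient.mk _) (star_star x)
  star_mul := Quotient.ind₂ fun x y => congrArg (Quotient.mk _) (star_mul x y)
  star_add := Quotient.ind₂ fun x y => congrArg (Quotient.mk _) (star_add x y)

/-- An MF algebra: a separable `C*`-algebra which embeds in a corona
`∏ᵢ M_{k(i)}(ℂ) / ⨁ᵢ M_{k(i)}(ℂ)` for some sequence of positive integers `k(i)`. -/
def IsMF (B : Type*) [NonUnitalCStarAlgebra B] : Prop :=
  TopologicalSpace.SeparableSpace B ∧
    ∃ (k : ℕ → ℕ+) (φ : B →⋆ₙₐ[ℂ] MatrixCorona k), Function.Injective φ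

/-- A unital `C*`-algebra has a nonzero MF quotient if it maps onto some nonzero MF algebra. (Up to
isomorphism, the quotients of a `C*`-algebra by closed two-sided ideals are the `C*`-algebras onto
which it maps.) -/
def HasNonzeroMFQuotient.{u} (A : Type u) [CStarAlgebra A] : Prop :=
  ∃ (B : Type u) (_ : CStarAlgebra B) (π : A →⋆ₐ[ℂ] B),
    Function.Surjective π ∧ Nontrivial B ∧ IsMF B

end MF

/-! ### Stability -/

section Stability

/-- Local-to-local stability of `Γ` with respect to a class of unital `C*`-algebras, given as a family
`(B i)`: every asymptotically multiplicative sequence of unital maps into unitary groups of members of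
the class is pointwise close to a sequence of homomorphisms into the same unitary groups. -/
def LocalToLocalStable (Γ : Type*) [Group Γ] {ι : Type*} (B : ι → Type*)
    [∀ i, CStarAlgebra (B i)] : Prop :=
  ∀ (j : ℕ → ι) (ρ : ∀ n, Γ → unitary (B (j n))),
    (∀ n, ρ n 1 = 1) →
    (∀ s t, Tendsto (fun n => ‖(ρ n (s * t) : B (j n)) - ρ n s * ρ n t‖) atTop (𝓝 0)) →
    ∃ π : ∀ n, Γ →* unitary (B (j n)),
      ∀ s, Tendsto (fun n => ‖(ρ n s : B (j n)) - π n s‖) atTop (𝓝 0)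

/-- Matricial stability: local-to-local stability with respect to the matrix algebras `M_k(ℂ)`,
`k ≥ 1`, with the operator norm. -/
def MatriciallyStable (Γ : Type*) [Group Γ] : Prop :=
  LocalToLocalStable Γ fun k : ℕ+ => Matrix (Fin k) (Fin k) ℂ

end Stability

end

noncomputable section

/-! The idea is that stability would make σ a pointwise limit of coboundaries, and such a limit is
itself a coboundary.

Composing `s ↦ δ_s` with the quotient map and the embedding into a corona gives a σ_θ-projective
unitary representation in a corner of the corona. Lifting the unit of the corner to projections of
finite rank, compressing, and taking polar parts gives maps ρ_n into matrix unitaries with `ρ_n(s)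
ρ_n(t) ≈ exp(2πiθ_n σ(s,t)) ρ_n(st)` (`exists_almost_projective_of_hasNonzeroMFQuotient`). The error
may be chosen as small as desired, and is taken to be o(θ_n). Since θ_n → 0 the phases tend to 1, so
ρ_n is asymptotically multiplicative and stability supplies nearby homomorphisms π_n.

The obstruction is a determinant with a logarithm. The unitaries `g_n(s) = ρ_n(s) π_n(s)⁻¹` are near
1, so `-i Tr log` (`traceArg`) is defined on them. Near 1 this function is additive (`traceArg_mul`)
and conjugation invariant (`traceArg_conj`). Moving π_n(s) past g_n(t) only conjugates g_n(t), so
the coboundary of `traceArg ∘ g_n` at (s,t) is `2πθ_n σ(s,t)` times the matrix size r_n, up to r_n ·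
o(θ_n) (`abs_traceArg_add_sub_le`). Dividing by `2πθ_n r_n` gives real cochains whose coboundaries
converge pointwise to σ, and `mem_twoCoboundaries_of_tendsto` concludes. -/

/-! ### Pointwise closedness of the real coboundaries -/

/-- A cocycle which is a pointwise limit of coboundaries is a coboundary. -/
theorem mem_twoCoboundaries_of_tendsto {Γ : Type*} [Group Γ] (σ : twoCocycles Γ ℝ)
    (γ : ℕ → Γ → ℝ)
    (h : ∀ a b, Tendsto (fun n => γ n a - γ n (a * b) + γ n b) atTop (𝓝 (σ.1 a b))) :
    σ ∈ twoCoboundaries Γ ℝ := by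
  -- `d` is the boundary map of chains. A function on pairs is a coboundary exactly when its linear
  -- extension factors through `d`; over a field this means vanishing on `ker d`. Each element of
  -- the kernel involves finitely many pairs, so vanishing there survives pointwise limits.
  let d : (Γ × Γ →₀ ℝ) →ₗ[ℝ] (Γ →₀ ℝ) := Finsupp.linearCombination ℝ fun p =>
    Finsupp.single p.1 1 - Finsupp.single (p.1 * p.2) 1 + Finsupp.single p.2 1
  let φ : Module.Dual ℝ (Γ × Γ →₀ ℝ) := Finsupp.linearCombination ℝ fun p => σ.1 p.1 p.2
  have hφ : φ ∈ (LinearMap.ker d).dualAnnihilator := by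
    rw [Submodule.mem_dualAnnihilator]
    intro z hz
    have h1 : Tendsto (fun n => ∑ p ∈ z.support, z p * (γ n p.1 - γ n (p.1 * p.2) + γ n p.2))
        atTop (𝓝 (∑ p ∈ z.support, z p * σ.1 p.1 p.2)) :=
      tendsto_finsetSum _ fun p _ => (h p.1 p.2).const_mul _
    have h2 : ∀ n, ∑ p ∈ z.support, z p * (γ n p.1 - γ n (p.1 * p.2) + γ n p.2) = 0 := fun n => by
      have h3 := congrArg (Finsupp.linearCombination ℝ (γ n)) (LinearMap.mem_ker.1 hz)
      have h4 : d z = ∑ p ∈ z.support, z p • (Finsupp.single p.1 1 -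
          Finsupp.single (p.1 * p.2) 1 + Finsupp.single p.2 1) :=
        Finsupp.linearCombination_apply _ _
      rw [h4] at h3
      simpa [mul_add] using h3
    simp only [h2] at h1
    exact (tendsto_nhds_unique h1 tendsto_const_nhds).trans rfl
  rw [← LinearMap.range_dualMap_eq_dualAnnihilator_ker] at hφ
  obtain ⟨ψ, hψ⟩ := hφ
  refine ⟨fun s => ψ (Finsupp.single s 1), fun a b => ?_⟩
  have := LinearMap.congr_fun hψ (Finsupp.single (a, b) 1)
  simpa [d, φ, Finsupp.linearCombination_single] using this.symm

/-! ### The trace of the logarithm of a unitary near the identity -/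

section TraceArg

open Complex selfAdjoint Unitary

variable {m : Type*} [Fintype m] [DecidableEq m]

/-- Diagonalise `x` by a unitary: conjugation changes neither side, and for diagonal matrices the
exponential of a sum is the product of exponentials. -/
theorem det_expUnitary (x : selfAdjoint (Matrix m m ℂ)) :
    (expUnitary x : Matrix m m ℂ).det = exp (I * (x : Matrix m m ℂ).trace) := by
  have hx : (x : Matrix m m ℂ).IsHermitian := x.2
  set U := hx.eigenvectorUnitary
  set D : Matrix m m ℂ := Matrix.diagonal (RCLike.ofReal ∘ hx.eigenvalues)
  have h1 : (x : Matrix m m ℂ) = U * D * (star U : Matrix m m ℂ) := hx.spectral_theorem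
  have h2 : (expUnitary x : Matrix m m ℂ) =
      U * NormedSpace.exp (I • D) * (star U : Matrix m m ℂ) := by
    rw [expUnitary_coe]
    have h3 := Matrix.exp_units_conj (Unitary.toUnits U) (I • D)
    rw [show (I • (x : Matrix m m ℂ)) = U * (I • D) * (star U : Matrix m m ℂ) by
      rw [h1]; simp]
    exact h3
  have h4 : (U : Matrix m m ℂ).det * (star U : Matrix m m ℂ).det = 1 := by
    rw [← Matrix.det_mul, show (U : Matrix m m ℂ) * (star U : Matrix m m ℂ) = 1 from U.2.2,
      Matrix.det_one]
  have h5 : (x : Matrix m m ℂ).trace = D.trace := by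
    rw [h1, Matrix.trace_mul_cycle, Unitary.coe_star_mul_self, one_mul]
  rw [h2, h5, Matrix.det_mul, Matrix.det_mul, mul_right_comm, h4, one_mul, ← Matrix.diagonal_smul,
    Matrix.exp_diagonal, Matrix.det_diagonal, Matrix.trace_diagonal, Finset.mul_sum, Complex.exp_sum]
  refine Finset.prod_congr rfl fun i _ => ?_
  rw [Pi.coe_exp]
  simp [Complex.exp_eq_exp_ℂ]

/-- The trace of the logarithm, divided by `i`, of a unitary matrix. -/
def traceArg (u : unitary (Matrix m m ℂ)) : ℝ :=
  ((argSelfAdjoint u : Matrix m m ℂ).trace).re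

omit [DecidableEq m] in
theorem trace_selfAdjoint_eq_re (x : selfAdjoint (Matrix m m ℂ)) :
    (x : Matrix m m ℂ).trace = (((x : Matrix m m ℂ).trace).re : ℂ) := by
  refine (Complex.conj_eq_iff_re.1 ?_).symm
  have h := Matrix.trace_conjTranspose (x : Matrix m m ℂ)
  rw [show (x : Matrix m m ℂ).conjTranspose = x from x.2] at h
  exact h.symm

/-- The determinant is multiplicative, so this gives additivity of `traceArg` modulo 2π. The bound 2
keeps -1, where `arg` jumps, out of the spectrum of `u`. -/
theorem exp_traceArg {u : unitary (Matrix m m ℂ)} (hu : ‖(u - 1 : Matrix m m ℂ)‖ < 2) :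
    exp (I * traceArg u) = (u : Matrix m m ℂ).det := by
  rw [traceArg, ← trace_selfAdjoint_eq_re, ← det_expUnitary, expUnitary_argSelfAdjoint hu]

theorem traceArg_one : traceArg (1 : unitary (Matrix m m ℂ)) = 0 := by
  have h := argSelfAdjoint_expUnitary (A := Matrix m m ℂ) (x := 0) (by simpa using Real.pi_pos)
  rw [expUnitary_zero] at h
  simp [traceArg, h]

theorem continuousOn_traceArg :
    ContinuousOn (traceArg (m := m)) (Metric.ball 1 2) := by
  have h : Continuous fun x : selfAdjoint (Matrix m m ℂ) => ((x : Matrix m m ℂ).trace).re :=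
    Complex.continuous_re.comp (Continuous.matrix_trace continuous_subtype_val)
  exact h.comp_continuousOn continuousOn_argSelfAdjoint

theorem norm_mul_sub_one_le (u v : unitary (Matrix m m ℂ)) :
    ‖((u * v : unitary (Matrix m m ℂ)) - 1 : Matrix m m ℂ)‖ ≤
      ‖(u - 1 : Matrix m m ℂ)‖ + ‖(v - 1 : Matrix m m ℂ)‖ := by
  have h : ((u * v : unitary (Matrix m m ℂ)) - 1 : Matrix m m ℂ) =
      u * (v - 1 : Matrix m m ℂ) + (u - 1 : Matrix m m ℂ) := by
    rw [Submonoid.coe_mul]; noncomm_ring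
  rw [h, add_comm ‖_‖]
  exact (norm_add_le _ _).trans_eq (by rw [CStarRing.norm_coe_unitary_mul])

/-- Additivity of `traceArg` near the identity. -/
theorem traceArg_mul {u v : unitary (Matrix m m ℂ)}
    (huv : ‖(u - 1 : Matrix m m ℂ)‖ + ‖(v - 1 : Matrix m m ℂ)‖ < 2) :
    traceArg (u * v) = traceArg u + traceArg v := by
  have hu : ‖(u - 1 : Matrix m m ℂ)‖ < 2 := by linarith [norm_nonneg (v - 1 : Matrix m m ℂ)]
  have hv : ‖(v - 1 : Matrix m m ℂ)‖ < 2 := by linarith [norm_nonneg (u - 1 : Matrix m m ℂ)]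
  -- Both unitaries are contracted to 1 along one-parameter groups, which stay in the region where
  -- `traceArg` is continuous.
  let a : ℝ → unitary (Matrix m m ℂ) := fun t => expUnitary (t • argSelfAdjoint u)
  let b : ℝ → unitary (Matrix m m ℂ) := fun t => expUnitary (t • argSelfAdjoint v)
  have ha : Continuous a := by fun_prop
  have hb : Continuous b := by fun_prop
  have ha' : ∀ t ∈ Set.Icc (0 : ℝ) 1, ‖(a t - 1 : Matrix m m ℂ)‖ ≤ ‖(u - 1 : Matrix m m ℂ)‖ :=
    fun t ht => norm_expUnitary_smul_argSelfAdjoint_sub_one_le u ht hu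
  have hb' : ∀ t ∈ Set.Icc (0 : ℝ) 1, ‖(b t - 1 : Matrix m m ℂ)‖ ≤ ‖(v - 1 : Matrix m m ℂ)‖ :=
    fun t ht => norm_expUnitary_smul_argSelfAdjoint_sub_one_le v ht hv
  have hab' : ∀ t ∈ Set.Icc (0 : ℝ) 1,
      ‖((a t * b t : unitary (Matrix m m ℂ)) - 1 : Matrix m m ℂ)‖ < 2 := fun t ht =>
    (norm_mul_sub_one_le _ _).trans_lt (by linarith [ha' t ht, hb' t ht])
  have mem : ∀ {w : unitary (Matrix m m ℂ)}, ‖(w - 1 : Matrix m m ℂ)‖ < 2 →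
      w ∈ Metric.ball (1 : unitary (Matrix m m ℂ)) 2 := fun {w} hw => by
    rw [Metric.mem_ball, Subtype.dist_eq, dist_eq_norm]; exact hw
  -- The additivity defect is continuous in `t`, takes values in 2πℤ by multiplicativity of the
  -- determinant, and is 0 at `t = 0`; hence it vanishes at `t = 1`.
  let f : ℝ → ℝ := fun t => traceArg (a t * b t) - traceArg (a t) - traceArg (b t)
  have hf : ContinuousOn f (Set.Icc 0 1) :=
    ((continuousOn_traceArg.comp (ha.mul hb).continuousOn fun t ht => mem (hab' t ht)).sub
      (continuousOn_traceArg.comp ha.continuousOn fun t ht => mem ((ha' t ht).trans_lt hu))).sub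
      (continuousOn_traceArg.comp hb.continuousOn fun t ht => mem ((hb' t ht).trans_lt hv))
  have hint : ∀ t ∈ Set.Icc (0 : ℝ) 1, f t ∈ Set.range fun n : ℤ => (n : ℝ) * (2 * Real.pi) := by
    intro t ht
    have h1 : exp (I * (f t : ℂ)) = 1 := by
      have e : I * (f t : ℂ) = I * traceArg (a t * b t) - I * traceArg (a t) -
          I * traceArg (b t) := by simp only [f]; push_cast; ring
      rw [e, Complex.exp_sub, Complex.exp_sub, exp_traceArg (hab' t ht),
        exp_traceArg ((ha' t ht).trans_lt hu), exp_traceArg ((hb' t ht).trans_lt hv),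
        Submonoid.coe_mul, Matrix.det_mul, div_div, div_self]
      rw [← exp_traceArg ((ha' t ht).trans_lt hu), ← exp_traceArg ((hb' t ht).trans_lt hv)]
      exact mul_ne_zero (Complex.exp_ne_zero _) (Complex.exp_ne_zero _)
    obtain ⟨n, hn⟩ := Complex.exp_eq_one_iff.1 h1
    refine ⟨n, ?_⟩
    have h2 : (f t : ℂ) = ((n * (2 * Real.pi) : ℝ) : ℂ) := by
      push_cast
      refine mul_left_cancel₀ I_ne_zero ?_
      rw [hn]; ring
    exact_mod_cast h2.symm
  have hdisc : IsDiscrete (Set.range ((↑) : ℤ → ℝ)) := by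
    rw [isDiscrete_iff_discreteTopology]
    exact Int.isClosedEmbedding_coe_real.isEmbedding.toHomeomorph.symm.isEmbedding.discreteTopology
  have hconst : f 1 / (2 * Real.pi) = f 0 / (2 * Real.pi) := by
    refine isPreconnected_Icc.constant_of_mapsTo hdisc (f := fun t => f t / (2 * Real.pi))
      (hf.div_const _) (fun t ht => ?_) (by simp) (by simp)
    obtain ⟨n, hn⟩ := hint t ht
    exact ⟨n, by dsimp only at hn ⊢; rw [← hn, mul_div_cancel_right₀ _ Real.two_pi_pos.ne']⟩
  rw [div_left_inj' Real.two_pi_pos.ne'] at hconst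
  have h0 : f 0 = 0 := by simp [f, a, b, traceArg_one]
  have h1 : f 1 = traceArg (u * v) - traceArg u - traceArg v := by
    simp only [f, a, b, one_smul, expUnitary_argSelfAdjoint hu, expUnitary_argSelfAdjoint hv]
  linarith

/-- Functional calculus commutes with inner automorphisms, and the trace does not see them. The
discontinuity of `arg` is harmless because the spectrum of a matrix is finite. -/
theorem traceArg_conj (v u : unitary (Matrix m m ℂ)) :
    traceArg (v * u * v⁻¹) = traceArg u := by
  have h := StarAlgHomClass.map_cfc (S := ℂ) (Unitary.conjStarAlgAut ℂ (Matrix m m ℂ) v)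
    (fun z : ℂ => (arg z : ℂ)) (u : Matrix m m ℂ)
    (hf := (Matrix.finite_spectrum _).continuousOn _)
    (hφ := by
      have : Continuous fun x : Matrix m m ℂ => (v : Matrix m m ℂ) * x * (star v : Matrix m m ℂ) := by
        fun_prop
      exact this)
    (ha := by exact (inferInstance : IsStarNormal (u : Matrix m m ℂ)))
    (hφa := by exact (inferInstance : IsStarNormal ((v * u * v⁻¹ : unitary (Matrix m m ℂ)) : Matrix m m ℂ)))
  have h' : (v : Matrix m m ℂ) * (argSelfAdjoint u : Matrix m m ℂ) * (star v : Matrix m m ℂ) =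
    argSelfAdjoint (v * u * v⁻¹) := h
  rw [traceArg, ← h', Matrix.trace_mul_cycle, Unitary.coe_star_mul_self, one_mul, traceArg]

theorem norm_matrix_entry_le (A : Matrix m m ℂ) (i j : m) : ‖A i j‖ ≤ ‖A‖ := by
  have h := Matrix.l2_opNorm_mulVec A (EuclideanSpace.single j 1)
  have h' := (PiLp.norm_apply_le ((EuclideanSpace.equiv m ℂ).symm
    (A.mulVec (EuclideanSpace.single j (1 : ℂ)))) i).trans h
  simpa using h'

theorem abs_re_trace_le (A : Matrix m m ℂ) : |A.trace.re| ≤ Fintype.card m * ‖A‖ := by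
  refine (Complex.abs_re_le_norm _).trans ((norm_sum_le _ _).trans ?_)
  refine (Finset.sum_le_card_nsmul _ _ ‖A‖ fun i _ => norm_matrix_entry_le A i i).trans_eq ?_
  rw [nsmul_eq_mul, Finset.card_univ]

/-- Chord against arc: `2(1 - cos x) = ‖u - 1‖²` and `cos x ≤ 1 - 2x²/π²` on [-π, π]. The crude
bound `π ≤ 4` turns the sharp constant π/2 into 2. -/
theorem norm_argSelfAdjoint_le {u : unitary (Matrix m m ℂ)} (hu : ‖(u - 1 : Matrix m m ℂ)‖ < 2) :
    ‖argSelfAdjoint u‖ ≤ 2 * ‖(u - 1 : Matrix m m ℂ)‖ := by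
  have h1 := two_mul_one_sub_cos_norm_argSelfAdjoint hu
  have h2 := norm_argSelfAdjoint_le_pi u
  set x := ‖argSelfAdjoint u‖
  have hx : 0 ≤ x := norm_nonneg _
  have h3 := Real.cos_le_one_sub_mul_cos_sq (x := x) (by rwa [abs_of_nonneg hx])
  have h4 : x ^ 2 ≤ (2 * ‖(u - 1 : Matrix m m ℂ)‖) ^ 2 := by
    have h5 : 1 / 8 ≤ 2 / Real.pi ^ 2 := by
      rw [div_le_div_iff₀ (by norm_num) (by positivity)]
      nlinarith [Real.pi_le_four, Real.pi_pos]
    nlinarith [mul_le_mul_of_nonneg_right h5 (sq_nonneg x)]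
  exact (sq_le_sq₀ hx (by positivity)).1 h4

/-- Growth linear in the matrix size is affordable, since the cochains built later are divided by
that size. -/
theorem abs_traceArg_le {u : unitary (Matrix m m ℂ)} (hu : ‖(u - 1 : Matrix m m ℂ)‖ < 2) :
    |traceArg u| ≤ Fintype.card m * (2 * ‖(u - 1 : Matrix m m ℂ)‖) :=
  (abs_re_trace_le _).trans (mul_le_mul_of_nonneg_left (norm_argSelfAdjoint_le hu) (by positivity))

theorem norm_circle_exp_sub_one_le (α : ℝ) : ‖((Circle.exp α : ℂ) - 1)‖ ≤ |α| := by
  rw [Circle.coe_exp, mul_comm]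
  exact (Real.norm_exp_I_mul_ofReal_sub_one_le).trans_eq (Real.norm_eq_abs _)

section Scalar

variable {A : Type*} [CStarAlgebra A]

variable (A) in
/-- A real number as a self-adjoint element. -/
def realScalar (α : ℝ) : selfAdjoint A := α • 1

theorem coe_realScalar (α : ℝ) : (realScalar A α : A) = (α : ℂ) • (1 : A) := by
  simp [realScalar]

theorem norm_realScalar_le (α : ℝ) : ‖realScalar A α‖ ≤ |α| := by
  nontriviality A
  change ‖(realScalar A α : A)‖ ≤ _
  rw [coe_realScalar, norm_smul, CStarRing.norm_one, mul_one,
    Complex.norm_real, Real.norm_eq_abs]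

theorem coe_expUnitary_realScalar (α : ℝ) :
    (expUnitary (realScalar A α) : A) = (Circle.exp α : ℂ) • (1 : A) := by
  rw [expUnitary_coe, coe_realScalar, smul_smul, ← Algebra.algebraMap_eq_smul_one,
    ← NormedSpace.algebraMap_exp_comm, ← Algebra.algebraMap_eq_smul_one, Circle.coe_exp, mul_comm,
    Complex.exp_eq_exp_ℂ]

theorem norm_expUnitary_realScalar_sub_one_le (α : ℝ) :
    ‖(expUnitary (realScalar A α) - 1 : A)‖ ≤ |α| := by
  nontriviality A
  have h : (Circle.exp α : ℂ) • (1 : A) - 1 = ((Circle.exp α : ℂ) - 1) • 1 := by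
    rw [sub_smul, one_smul]
  rw [coe_expUnitary_realScalar, h, norm_smul, CStarRing.norm_one, mul_one]
  exact norm_circle_exp_sub_one_le α

end Scalar

theorem traceArg_expUnitary_realScalar {α : ℝ} (hα : |α| < Real.pi) :
    traceArg (expUnitary (realScalar (Matrix m m ℂ) α)) = Fintype.card m * α := by
  rw [traceArg, argSelfAdjoint_expUnitary ((norm_realScalar_le α).trans_lt hα), coe_realScalar]
  simp [mul_comm]

/-- If `(ha p) (hb q)` is close to `e^{iα} hc (p q)` with `ha`, `hb`, `hc` near `1` and `α` small, then
`traceArg ha + traceArg hb - traceArg hc` is close to the trace of `α`. -/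
theorem abs_traceArg_add_sub_le {ha hb hc p q : unitary (Matrix m m ℂ)} {α ε : ℝ}
    (h1 : ‖(ha - 1 : Matrix m m ℂ)‖ ≤ 1 / 4) (h2 : ‖(hb - 1 : Matrix m m ℂ)‖ ≤ 1 / 4)
    (h3 : ‖(hc - 1 : Matrix m m ℂ)‖ ≤ 1 / 4) (hα : |α| ≤ 1 / 4) (hε : ε ≤ 1 / 4)
    (h : ‖((ha * p * (hb * q) : unitary (Matrix m m ℂ)) : Matrix m m ℂ) -
      (Circle.exp α : ℂ) • ((hc * (p * q) : unitary (Matrix m m ℂ)) : Matrix m m ℂ)‖ ≤ ε) :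
    |traceArg ha + traceArg hb - traceArg hc - Fintype.card m * α| ≤
      Fintype.card m * (2 * ε) := by
  set z := expUnitary (realScalar (Matrix m m ℂ) α) with hz
  have hzn : ‖(z - 1 : Matrix m m ℂ)‖ ≤ |α| := norm_expUnitary_realScalar_sub_one_le α
  have hzt : traceArg z = Fintype.card m * α :=
    traceArg_expUnitary_realScalar (by linarith [Real.pi_gt_three])
  -- Write `ha p hb q = ha (p hb p⁻¹) (p q)`: the factor `p q` then cancels against the other side,
  -- and the conjugation is invisible to `traceArg`.
  set hb' := p * hb * p⁻¹
  have hb'n : ‖(hb' - 1 : Matrix m m ℂ)‖ = ‖(hb - 1 : Matrix m m ℂ)‖ := by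
    have e : (hb' - 1 : Matrix m m ℂ) = p * (hb - 1 : Matrix m m ℂ) * (p⁻¹ : unitary (Matrix m m ℂ)) := by
      have e' : (p : Matrix m m ℂ) * (p⁻¹ : unitary (Matrix m m ℂ)) = 1 :=
        congrArg Subtype.val (mul_inv_cancel p)
      rw [mul_sub, sub_mul, mul_one, e']
      rfl
    rw [e, CStarRing.norm_mul_coe_unitary, CStarRing.norm_coe_unitary_mul]
  -- `w` is the multiplicative error, defined by `ha hb' = w z hc`. The bounds 1/4 keep all products
  -- within the range of `traceArg_mul`.
  set w := ha * hb' * (z * hc)⁻¹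
  have hw : ‖(w - 1 : Matrix m m ℂ)‖ ≤ ε := by
    have e : ((ha * p * (hb * q) : unitary (Matrix m m ℂ)) : Matrix m m ℂ) -
      (Circle.exp α : ℂ) • ((hc * (p * q) : unitary (Matrix m m ℂ)) : Matrix m m ℂ) =
        (w - 1 : Matrix m m ℂ) * (z * hc * (p * q) : unitary (Matrix m m ℂ)) := by
      have hz' : ∀ x : unitary (Matrix m m ℂ), ((z * x : unitary (Matrix m m ℂ)) : Matrix m m ℂ) =
          (Circle.exp α : ℂ) • (x : Matrix m m ℂ) := fun x => by
        rw [Submonoid.coe_mul, hz, coe_expUnitary_realScalar, smul_mul_assoc, one_mul]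
      have hw' : ha * p * (hb * q) = w * (z * hc * (p * q)) := by
        simp only [w, hb']
        group
      rw [sub_mul, one_mul, ← Submonoid.coe_mul, ← hw', mul_assoc z, hz']
    rwa [e, CStarRing.norm_mul_coe_unitary] at h
  have hwz : ‖(w - 1 : Matrix m m ℂ)‖ + ‖((z * hc : unitary (Matrix m m ℂ)) - 1 : Matrix m m ℂ)‖ < 2 := by
    linarith [norm_mul_sub_one_le z hc]
  have e1 := traceArg_mul hwz
  have e2 := traceArg_mul (u := z) (v := hc) (by linarith)
  have e3 := traceArg_mul (u := ha) (v := hb') (by linarith)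
  rw [show w * (z * hc) = ha * hb' from inv_mul_cancel_right _ _] at e1
  have e4 : traceArg hb' = traceArg hb := traceArg_conj p hb
  have e5 := abs_traceArg_le (u := w) (by linarith)
  have e6 : traceArg ha + traceArg hb - traceArg hc - Fintype.card m * α = traceArg w := by
    linarith
  rw [e6]
  exact e5.trans (by gcongr)

end TraceArg

/-! ### Perturbation to exact unitaries and exact projections -/

section Polar

variable {m k : Type*} [Fintype m] [DecidableEq m] [Fintype k] [DecidableEq k]

open scoped MatrixOrder in
/-- A matrix which is almost an isometry is close to a unitary. -/
theorem exists_unitary_norm_sub_le (Y : Matrix m m ℂ) (hY : ‖1 - star Y * Y‖ < 1) :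
    ∃ u : unitary (Matrix m m ℂ), ‖(u : Matrix m m ℂ) - Y‖ ≤ ‖1 - star Y * Y‖ := by
  set a := star Y * Y
  have ha : 0 ≤ a := star_mul_self_nonneg Y
  have haU : IsUnit a := by
    have := isUnit_one_sub_of_norm_lt_one hY
    rwa [sub_sub_cancel] at this
  set b := CFC.sqrt a
  have hbb : b * b = a := CFC.sqrt_mul_sqrt_self a ha
  have hb0 : 0 ≤ b := CFC.sqrt_nonneg a
  have hbs : star b = b := (IsSelfAdjoint.of_nonneg hb0).star_eq
  have hbU : IsUnit b := by
    rw [Matrix.isUnit_iff_isUnit_det] at haU ⊢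
    rw [← hbb, Matrix.det_mul] at haU
    exact isUnit_of_mul_isUnit_left haU
  obtain ⟨c, hc⟩ := hbU
  have hcb : (↑c⁻¹ : Matrix m m ℂ) * b = 1 := by rw [← hc]; exact c.inv_mul
  have hbc : b * (↑c⁻¹ : Matrix m m ℂ) = 1 := by rw [← hc]; exact c.mul_inv
  have hcs : star (↑c⁻¹ : Matrix m m ℂ) * b = 1 := by
    have := congrArg star hbc
    rwa [star_mul, hbs, star_one] at this
  -- The unitary part of the polar decomposition: `b = |Y|`, and `c` is `b` as a unit.
  set u : Matrix m m ℂ := Y * (↑c⁻¹ : Matrix m m ℂ)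
  have hu : star u * u = 1 := by
    calc star u * u = star (↑c⁻¹ : Matrix m m ℂ) * a * (↑c⁻¹ : Matrix m m ℂ) := by
          simp only [u, a, star_mul, mul_assoc]
      _ = (star (↑c⁻¹ : Matrix m m ℂ) * b) * (b * (↑c⁻¹ : Matrix m m ℂ)) := by
          rw [← hbb]; simp only [mul_assoc]
      _ = 1 := by rw [hcs, hbc, one_mul]
  let U : unitary (Matrix m m ℂ) := ⟨u, hu, mul_eq_one_comm.1 hu⟩
  refine ⟨U, ?_⟩
  have hY' : u - Y = u * (1 - b) := by
    rw [mul_sub, mul_one]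
    simp only [u, mul_assoc, hcb, mul_one]
  have h1 : ‖u - Y‖ = ‖1 - b‖ := by
    rw [hY']; exact CStarRing.norm_coe_unitary_mul U _
  change ‖u - Y‖ ≤ _
  rw [h1]
  have e1 : 1 - b = cfc (fun x : ℝ => 1 - x) b := by
    rw [cfc_sub .., cfc_id' .., cfc_const_one ..]
  have e2 : 1 - a = cfc (fun x : ℝ => 1 - x * x) b := by
    rw [cfc_sub .., cfc_const_one .., cfc_mul .., cfc_id' .., hbb]
  rw [e1, e2]
  -- On the spectrum of `b` one has `x ≥ 0`, hence `|1 - x| ≤ |1 - x| (1 + x) = |1 - x²|`.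
  refine norm_cfc_le (norm_nonneg _) fun x hx => ?_
  refine le_trans ?_ (norm_apply_le_norm_cfc (fun x : ℝ => 1 - x * x) b hx)
  have hx0 : 0 ≤ x := spectrum_nonneg_of_nonneg hb0 hx
  rw [show 1 - x * x = (1 - x) * (1 + x) by ring, norm_mul]
  refine le_mul_of_one_le_right (norm_nonneg _) ?_
  rw [Real.norm_eq_abs, abs_of_nonneg (by linarith)]
  linarith

/-- A Hermitian matrix which is almost idempotent is close to the range projection of an isometry. -/
theorem exists_isometry_norm_sub_le {Q : Matrix k k ℂ} (hQ : Q.IsHermitian) :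
    ∃ (r : ℕ) (V : Matrix k (Fin r) ℂ), V.conjTranspose * V = 1 ∧
      ‖V * V.conjTranspose - Q‖ ≤ 2 * ‖Q * Q - Q‖ := by
  set U := hQ.eigenvectorUnitary
  set l := hQ.eigenvalues
  -- Eigenvalues are rounded to 0 or 1 at the threshold 1/2; `J` includes the coordinates rounded to
  -- 1. `S` may be empty, in which case the rank is 0.
  set S := {j : k // 1 / 2 < l j}
  let e : Fin (Fintype.card S) ≃ S := (Fintype.equivFin S).symm
  let J : Matrix k (Fin (Fintype.card S)) ℂ := Matrix.of fun i j => if i = e j then 1 else 0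
  have hJ : J.conjTranspose * J = 1 := by
    ext i j
    simp [J, Matrix.mul_apply, Matrix.conjTranspose_apply, Matrix.one_apply, Subtype.val_inj, eq_comm]
  let D : Matrix k k ℂ := Matrix.diagonal fun j => (l j : ℂ)
  let E : Matrix k k ℂ := Matrix.diagonal fun j => if 1 / 2 < l j then 1 else 0
  have hJ' : J * J.conjTranspose = E := by
    ext i i'
    have h : (J * J.conjTranspose) i i' =
        ∑ s : S, (if i = s then (1 : ℂ) else 0) * (if i' = s then (1 : ℂ) else 0) := by
      rw [← e.sum_comp, Matrix.mul_apply]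
      refine Finset.sum_congr rfl fun j _ => ?_
      simp only [J, Matrix.conjTranspose_apply, Matrix.of_apply]
      congr 1
      split_ifs <;> simp
    rw [h]
    by_cases hi : 1 / 2 < l i
    · rw [Finset.sum_eq_single ⟨i, hi⟩]
      · by_cases hii : i = i'
        · subst hii
          simp only [E, Matrix.diagonal_apply_eq, if_pos hi, if_true, mul_one]
        · simp only [E, Matrix.diagonal_apply_ne _ hii, if_true, one_mul, if_neg (Ne.symm hii)]
      · intro s _ hs
        rw [if_neg fun h => hs (Subtype.ext h.symm), zero_mul]
      · simp
    · rw [Finset.sum_eq_zero]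
      · by_cases hii : i = i'
        · subst hii; simp only [E, Matrix.diagonal_apply_eq, if_neg hi]
        · simp [E, hii]
      · intro s _
        rw [if_neg fun h => hi (by rw [h]; exact s.2), zero_mul]
  have hU : (star U : Matrix k k ℂ) * U = 1 := U.2.1
  have hU' : (U : Matrix k k ℂ) * star U = 1 := U.2.2
  have hQD : Q = U * D * (star U : Matrix k k ℂ) := hQ.spectral_theorem
  have hQQ : Q * Q - Q = (U : Matrix k k ℂ) * (D * D - D) * (star U : Matrix k k ℂ) := by
    have : Q * Q = U * D * ((star U : Matrix k k ℂ) * U) * D * (star U : Matrix k k ℂ) := by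
      conv_lhs => rw [hQD]
      noncomm_ring
    rw [this, hU, hQD]
    noncomm_ring
  refine ⟨Fintype.card S, (U : Matrix k k ℂ) * J, ?_, ?_⟩
  · rw [Matrix.conjTranspose_mul, Matrix.mul_assoc, ← Matrix.mul_assoc _ (U : Matrix k k ℂ),
      show ((U : Matrix k k ℂ).conjTranspose * U) = 1 from hU, Matrix.one_mul, hJ]
  have e1 : (U : Matrix k k ℂ) * J * ((U : Matrix k k ℂ) * J).conjTranspose - Q =
      (U : Matrix k k ℂ) * (E - D) * (star U : Matrix k k ℂ) := by
    rw [Matrix.conjTranspose_mul, Matrix.mul_assoc, ← Matrix.mul_assoc J, hJ', hQD, mul_sub,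
      sub_mul, ← Matrix.mul_assoc]
    rfl
  have n1 : ∀ X : Matrix k k ℂ, ‖(U : Matrix k k ℂ) * X * (star U : Matrix k k ℂ)‖ = ‖X‖ := fun X => by
    have h1 := CStarRing.norm_mul_coe_unitary ((U : Matrix k k ℂ) * X) (star U)
    have h2 := CStarRing.norm_coe_unitary_mul U X
    exact h1.trans h2
  rw [e1, hQQ, n1, n1]
  simp only [D, E, Matrix.diagonal_mul_diagonal, Matrix.diagonal_sub, Matrix.l2_opNorm_diagonal]
  refine (pi_norm_le_iff_of_nonneg (by positivity)).2 fun j => ?_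
  have h3 := norm_le_pi_norm (fun j => (l j : ℂ) * l j - l j) j
  refine le_trans ?_ (mul_le_mul_of_nonneg_left h3 zero_le_two)
  have e3 : (l j : ℂ) * l j - l j = ((l j * (l j - 1) : ℝ) : ℂ) := by push_cast; ring
  have e4 : (if 1 / 2 < l j then (1 : ℂ) else 0) - l j =
    (((if 1 / 2 < l j then (1 : ℝ) else 0) - l j : ℝ) : ℂ) := by split_ifs <;> simp
  rw [e3, e4, Complex.norm_real, Complex.norm_real, Real.norm_eq_abs, Real.norm_eq_abs, abs_mul]
  -- The rounding error is one of `|l|`, `|l - 1|`, and the other one is at least 1/2; this is the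
  -- source of the factor 2.
  split_ifs with hj
  · rw [abs_of_pos (by linarith : 0 < l j), abs_sub_comm 1]
    nlinarith [abs_nonneg (l j - 1)]
  · rw [zero_sub, abs_neg, abs_of_nonpos (by linarith : l j - 1 ≤ 0)]
    nlinarith [abs_nonneg (l j)]

end Polar

/-! ### Finite dimensional models of projective representations in a corona -/

section Corona

namespace MatrixCorona

variable {k : ℕ → ℕ+}

/-- The quotient map from bounded sequences onto the corona. -/
def mk (x : MatrixProduct k) : MatrixCorona k := (nullSequenceCon k).toQuotient x

theorem mk_surjective : Function.Surjective (mk (k := k)) := Quotient.exists_rep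

theorem mk_eq_mk_iff {x y : MatrixProduct k} :
    mk x = mk y ↔ Tendsto (fun i => ‖x i - y i‖) atTop (𝓝 0) :=
  (nullSequenceCon k).eq

theorem mk_mul (x y : MatrixProduct k) : mk (x * y) = mk x * mk y := rfl

theorem mk_add (x y : MatrixProduct k) : mk (x + y) = mk x + mk y := rfl

theorem mk_smul (c : ℂ) (x : MatrixProduct k) : mk (c • x) = c • mk x := rfl

protected theorem one_smul (x : MatrixCorona k) : (1 : ℂ) • x = x := by
  obtain ⟨x, rfl⟩ := mk_surjective x
  rw [← mk_smul, one_smul]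

theorem mk_star (x : MatrixProduct k) : mk (star x) = star (mk x) := rfl

theorem mk_zero : mk (0 : MatrixProduct k) = 0 := rfl

/-- Projections in the corona lift to sequences of range projections of isometries. -/
theorem exists_isometry_lift {p : MatrixCorona k} (hs : star p = p) (hp : p * p = p) :
    ∃ (r : ℕ → ℕ) (V : ∀ i, Matrix (Fin (k i)) (Fin (r i)) ℂ) (q : MatrixProduct k),
      (∀ i, (V i).conjTranspose * V i = 1) ∧ (∀ i, q i = V i * (V i).conjTranspose) ∧
        mk q = p := by
  obtain ⟨P, rfl⟩ := mk_surjective p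
  -- Taking the self-adjoint part does not change the class and makes every coordinate Hermitian, so
  -- that its spectrum can be rounded.
  set Q : MatrixProduct k := (1 / 2 : ℂ) • (P + star P)
  have hQ : mk Q = mk P := by
    rw [mk_smul, mk_add, mk_star, hs, ← mk_add, ← mk_smul, ← two_smul ℂ, smul_smul]
    norm_num
  have hQs : ∀ i, (Q i).IsHermitian := fun i => by
    change star (Q i) = Q i
    simp only [Q, lp.coeFn_smul, Pi.smul_apply, lp.coeFn_add, Pi.add_apply, lp.star_apply,
      star_smul, star_add, star_star, add_comm (star (P i))]
    norm_num
  have hQQ : Tendsto (fun i => ‖(Q * Q) i - Q i‖) atTop (𝓝 0) := by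
    rw [← mk_eq_mk_iff, mk_mul, hQ, hp]
  choose r V hV hVQ using fun i => exists_isometry_norm_sub_le (hQs i)
  have hVQ' : ∀ i, ‖V i * (V i).conjTranspose - Q i‖ ≤ 2 * ‖(Q * Q) i - Q i‖ := hVQ
  let q : MatrixProduct k := ⟨fun i => V i * (V i).conjTranspose, by
    refine memℓp_infty ⟨2 * ‖Q * Q - Q‖ + ‖Q‖, ?_⟩
    rintro _ ⟨i, rfl⟩
    have h1 : ‖(Q * Q) i - Q i‖ ≤ ‖Q * Q - Q‖ := lp.norm_apply_le_norm ENNReal.top_ne_zero (Q * Q - Q) i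
    have h2 : ‖Q i‖ ≤ ‖Q‖ := lp.norm_apply_le_norm ENNReal.top_ne_zero Q i
    have h3 := norm_le_norm_sub_add (V i * (V i).conjTranspose) (Q i)
    dsimp only
    linarith [hVQ' i]⟩
  refine ⟨r, V, q, hV, fun i => rfl, ?_⟩
  rw [← hQ, mk_eq_mk_iff]
  refine squeeze_zero (fun i => norm_nonneg _) hVQ' (by simpa using hQQ.const_mul 2)

end MatrixCorona

theorem norm_conjTranspose_mul_mul_le {m n : Type*} [Fintype m] [DecidableEq m] [Fintype n]
    [DecidableEq n] {V : Matrix m n ℂ} (hV : V.conjTranspose * V = 1) (A : Matrix m m ℂ) :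
    ‖V.conjTranspose * A * V‖ ≤ ‖A‖ := by
  have h1 : ‖V‖ * ‖V‖ ≤ 1 := by
    rw [← Matrix.l2_opNorm_conjTranspose_mul_self, hV]
    -- When `n` is empty the identity matrix has norm 0, not 1.
    cases isEmpty_or_nonempty n
    · rw [Subsingleton.elim (1 : Matrix n n ℂ) 0, norm_zero]
      exact zero_le_one
    · exact CStarRing.norm_one.le
  calc ‖V.conjTranspose * A * V‖ ≤ ‖V‖ * ‖A‖ * ‖V‖ := by
        refine (Matrix.l2_opNorm_mul _ _).trans (mul_le_mul_of_nonneg_right ?_ (norm_nonneg _))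
        refine (Matrix.l2_opNorm_mul _ _).trans_eq ?_
        rw [Matrix.l2_opNorm_conjTranspose]
    _ = (‖V‖ * ‖V‖) * ‖A‖ := by ring
    _ ≤ ‖A‖ := mul_le_of_le_one_left (norm_nonneg _) h1

/-- Telescoping from `u v` to `c w` through `y z` and `c x`. The term `y (v - z)` costs `2δ` because
`δ ≤ 1` gives only `‖y‖ ≤ 2`; the other three cost `δ` each. -/
theorem norm_mul_sub_smul_le {A : Type*} [CStarAlgebra A] {u v w y z x : A} {c : ℂ} {δ : ℝ}
    (hv : ‖v‖ ≤ 1) (hu : ‖u‖ ≤ 1) (hc : ‖c‖ = 1) (hδ : δ ≤ 1) (h1 : ‖u - y‖ ≤ δ) (h2 : ‖v - z‖ ≤ δ)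
    (h3 : ‖w - x‖ ≤ δ) (h4 : ‖y * z - c • x‖ ≤ δ) : ‖u * v - c • w‖ ≤ 5 * δ := by
  have e : u * v - c • w = (u - y) * v + y * (v - z) + (y * z - c • x) - c • (w - x) := by
    rw [smul_sub]; noncomm_ring
  have hy : ‖y‖ ≤ 2 := by
    have := norm_sub_norm_le y u
    rw [norm_sub_rev] at this
    linarith
  have n1 : ‖(u - y) * v‖ ≤ δ := (norm_mul_le _ _).trans (by nlinarith [norm_nonneg (u - y)])
  have n2 : ‖y * (v - z)‖ ≤ 2 * δ :=
    (norm_mul_le _ _).trans (mul_le_mul hy h2 (norm_nonneg _) zero_le_two)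
  have n3 : ‖c • (w - x)‖ ≤ δ := by rwa [norm_smul, hc, one_mul]
  rw [e]
  linarith [norm_sub_le ((u - y) * v + y * (v - z) + (y * z - c • x)) (c • (w - x)),
    norm_add_le ((u - y) * v + y * (v - z)) (y * z - c • x), norm_add_le ((u - y) * v) (y * (v - z))]

variable {Γ : Type*} [Group Γ]

/-- A projective unitary representation in a corner of a corona yields finite dimensional almost
projective representations. -/
theorem exists_almost_projective_of_corona (ω : CircleCocycle Γ) {k : ℕ → ℕ+}
    (W : Γ → MatrixCorona k) (h0 : W 1 ≠ 0) (hone : star (W 1) = W 1)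
    (hstar : ∀ s, star (W s) * W s = W 1)
    (hmul : ∀ s t, W s * W t = (ω.toFun s t : ℂ) • W (s * t)) (F : Finset Γ) {ε : ℝ} (hε : 0 < ε) :
    ∃ (r : ℕ+) (ρ : Γ → unitary (Matrix (Fin r) (Fin r) ℂ)), ρ 1 = 1 ∧
      ∀ s ∈ F, ∀ t ∈ F, ‖(ρ s * ρ t : Matrix (Fin r) (Fin r) ℂ) -
        (ω.toFun s t : ℂ) • (ρ (s * t) : Matrix (Fin r) (Fin r) ℂ)‖ ≤ ε := by
  classical
  have hW1 : ∀ s, W 1 * W s = W s := fun s => by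
    rw [hmul, ω.map_one_left, one_mul]
    exact MatrixCorona.one_smul _
  obtain ⟨r, V, q, hV, hq, hqW⟩ := MatrixCorona.exists_isometry_lift hone (hW1 1)
  choose X hX using fun s => MatrixCorona.mk_surjective (W s)
  -- If the ranks were eventually 0, the lift `q` of `W 1` would be a null sequence. A coordinate of
  -- positive rank is needed for matrices of positive size.
  have hr : ∃ᶠ i in atTop, 0 < r i := by
    intro h
    refine h0 ?_
    rw [← hqW, ← MatrixCorona.mk_zero, MatrixCorona.mk_eq_mk_iff]
    refine tendsto_const_nhds.congr' ?_
    filter_upwards [h] with i hi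
    have hi0 : r i = 0 := by omega
    have : IsEmpty (Fin (r i)) := by rw [hi0]; infer_instance
    have e : q i = 0 := by
      rw [hq]; ext a b; simp [Matrix.mul_apply]
    simp [e]
  -- The 1/2 makes the compressions nearly isometric enough for a polar part; the ε/5 absorbs the
  -- constant of `norm_mul_sub_smul_le`.
  set δ := min (1 / 2) (ε / 5) with hδ_def
  have hδ : 0 < δ := by positivity
  -- The factor `q` appears because multiplying two compressions by `V` puts `V V* = q` between the
  -- factors.
  have T1 : ∀ s, ∀ᶠ i in atTop, ‖q i - (star (X s) * q * X s) i‖ < δ := fun s => by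
    refine (MatrixCorona.mk_eq_mk_iff.1 ?_).eventually_lt_const hδ
    rw [mul_assoc, MatrixCorona.mk_mul, MatrixCorona.mk_mul, MatrixCorona.mk_star, hX, hqW, hW1,
      hstar]
  have T2 : ∀ s t, ∀ᶠ i in atTop,
      ‖(X s * q * X t) i - ((ω.toFun s t : ℂ) • X (s * t)) i‖ < δ := fun s t => by
    refine (MatrixCorona.mk_eq_mk_iff.1 ?_).eventually_lt_const hδ
    rw [mul_assoc, MatrixCorona.mk_mul, MatrixCorona.mk_mul, MatrixCorona.mk_smul, hX, hX, hX, hqW,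
      hW1, hmul]
  have T3 : ∀ᶠ i in atTop, ‖q i - X 1 i‖ < δ :=
    (MatrixCorona.mk_eq_mk_iff.1 (by rw [hqW, hX])).eventually_lt_const hδ
  -- Products of elements of `F` are included since `ρ (s * t)` must be near its compression as
  -- well.
  have T1' : ∀ᶠ i in atTop, ∀ s ∈ F ∪ (F ×ˢ F).image (fun a => a.1 * a.2),
      ‖q i - (star (X s) * q * X s) i‖ < δ := (eventually_all_finset _).2 fun s _ => T1 s
  have T2' : ∀ᶠ i in atTop, ∀ s ∈ F, ∀ t ∈ F,
      ‖(X s * q * X t) i - ((ω.toFun s t : ℂ) • X (s * t)) i‖ < δ :=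
    (eventually_all_finset _).2 fun s _ => (eventually_all_finset _).2 fun t _ => T2 s t
  obtain ⟨i, hri, h1, h2, h3⟩ := (hr.and_eventually (T1'.and (T2'.and T3))).exists
  set Y : Γ → Matrix (Fin (r i)) (Fin (r i)) ℂ := fun s => (V i).conjTranspose * X s i * V i
  have hVqV : (V i).conjTranspose * q i * V i = 1 := by
    rw [hq, ← Matrix.mul_assoc, hV, Matrix.one_mul, hV]
  have hY1 : ∀ s, 1 - star (Y s) * Y s =
      (V i).conjTranspose * (q i - (star (X s) * q * X s) i) * V i := fun s => by
    rw [Matrix.mul_sub, Matrix.sub_mul, hVqV]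
    simp only [Y, lp.infty_coeFn_mul, Pi.mul_apply, lp.star_apply, hq, Matrix.star_eq_conjTranspose,
      Matrix.conjTranspose_mul, Matrix.conjTranspose_conjTranspose, Matrix.mul_assoc]
  have hY2 : ∀ s t, Y s * Y t - (ω.toFun s t : ℂ) • Y (s * t) =
      (V i).conjTranspose * ((X s * q * X t) i - ((ω.toFun s t : ℂ) • X (s * t)) i) * V i :=
    fun s t => by
    rw [Matrix.mul_sub, Matrix.sub_mul]
    simp only [Y, lp.infty_coeFn_mul, Pi.mul_apply, lp.coeFn_smul, Pi.smul_apply, hq,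
      Matrix.mul_assoc, Matrix.mul_smul, Matrix.smul_mul]
  have hY3 : 1 - Y 1 = (V i).conjTranspose * (q i - X 1 i) * V i := by
    rw [Matrix.mul_sub, Matrix.sub_mul, hVqV]
  have key : ∀ s, ∃ u : unitary (Matrix (Fin (r i)) (Fin (r i)) ℂ),
      ‖1 - star (Y s) * Y s‖ < 1 → ‖(u : Matrix (Fin (r i)) (Fin (r i)) ℂ) - Y s‖ ≤
        ‖1 - star (Y s) * Y s‖ := fun s => by
    by_cases h : ‖1 - star (Y s) * Y s‖ < 1
    · obtain ⟨u, hu⟩ := exists_unitary_norm_sub_le _ h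
      exact ⟨u, fun _ => hu⟩
    · exact ⟨1, fun h' => absurd h' h⟩
  choose u hu using key
  -- The value at 1 is set by hand to be exactly the identity; `T3` shows that `Y 1` is close to it.
  let ρ : Γ → unitary (Matrix (Fin (r i)) (Fin (r i)) ℂ) := fun s => if s = 1 then 1 else u s
  have hρ : ∀ s ∈ F ∪ (F ×ˢ F).image (fun a => a.1 * a.2),
      ‖(ρ s : Matrix (Fin (r i)) (Fin (r i)) ℂ) - Y s‖ ≤ δ := fun s hs => by
    by_cases hs1 : s = 1
    · subst hs1
      simp only [ρ, if_true]
      rw [OneMemClass.coe_one, hY3]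
      exact (norm_conjTranspose_mul_mul_le (hV i) _).trans h3.le
    · simp only [ρ, if_neg hs1]
      have h4 : ‖1 - star (Y s) * Y s‖ ≤ δ := by
        rw [hY1]
        exact (norm_conjTranspose_mul_mul_le (hV i) _).trans (h1 s hs).le
      exact (hu s (h4.trans_lt ((min_le_left _ _).trans_lt (by norm_num)))).trans h4
  have : Nonempty (Fin (r i)) := ⟨⟨0, hri⟩⟩
  have hρn : ∀ s, ‖(ρ s : Matrix (Fin (r i)) (Fin (r i)) ℂ)‖ ≤ 1 := fun s =>
    (CStarRing.norm_coe_unitary _).le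
  refine ⟨⟨r i, hri⟩, ρ, if_pos rfl, fun s hs t ht => ?_⟩
  refine (norm_mul_sub_smul_le (hρn t) (hρn s) (Circle.norm_coe _) ((min_le_left _ _).trans (by norm_num))
    (hρ s (Finset.mem_union_left _ hs)) (hρ t (Finset.mem_union_left _ ht))
    (hρ (s * t) (Finset.mem_union_right _ (Finset.mem_image.2 ⟨(s, t), by simp [hs, ht], rfl⟩)))
    ?_).trans (?_ : 5 * δ ≤ ε)
  · rw [hY2]
    exact (norm_conjTranspose_mul_mul_le (hV i) _).trans (h2 s hs t ht).le
  · linarith [min_le_right (1 / 2) (ε / 5)]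

/-- An MF quotient of the twisted group `C*`-algebra yields finite dimensional almost projective
representations. -/
theorem exists_almost_projective_of_hasNonzeroMFQuotient (ω : CircleCocycle Γ)
    (h : HasNonzeroMFQuotient (TwistedGroupCStarAlgebra ω)) (F : Finset Γ) {ε : ℝ} (hε : 0 < ε) :
    ∃ (r : ℕ+) (ρ : Γ → unitary (Matrix (Fin r) (Fin r) ℂ)), ρ 1 = 1 ∧
      ∀ s ∈ F, ∀ t ∈ F, ‖(ρ s * ρ t : Matrix (Fin r) (Fin r) ℂ) -
        (ω.toFun s t : ℂ) • (ρ (s * t) : Matrix (Fin r) (Fin r) ℂ)‖ ≤ ε := by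
  obtain ⟨B, _, π, -, _, -, k, φ, hφ⟩ := h
  let δ : Γ → TwistedGroupCStarAlgebra ω := fun s =>
    TwistedGroupCStarAlgebra.of ω (TwistedGroupAlgebra.single ω s 1)
  have hδ1 : δ 1 = 1 := rfl
  have hδs : ∀ s, star (δ s) * δ s = 1 := fun s => by
    rw [TwistedGroupCStarAlgebra.star_of, ← TwistedGroupCStarAlgebra.of_mul,
      TwistedGroupAlgebra.star_single_mul_single]
    rfl
  have hδm : ∀ s t, δ s * δ t = (ω.toFun s t : ℂ) • δ (s * t) := fun s t => by
    rw [← TwistedGroupCStarAlgebra.of_mul, ← TwistedGroupCStarAlgebra.of_smul,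
      TwistedGroupAlgebra.single_mul_single, TwistedGroupAlgebra.smul_single, mul_one, one_mul, mul_one]
  -- `φ` need not be unital, so `φ 1` is only a projection, nonzero by injectivity. This is why the
  -- previous result allows a corner with unit `W 1`.
  refine exists_almost_projective_of_corona ω (fun s => φ (π (δ s))) ?_ ?_ ?_ ?_ F hε
  · rw [hδ1, map_one, ← map_zero φ]
    exact hφ.ne one_ne_zero
  · rw [hδ1, map_one, ← map_star, star_one]
  · intro s
    rw [← map_star, ← map_mul, ← map_star, ← map_mul, hδs, hδ1]
  · intro s t
    rw [← map_mul, ← map_mul, hδm, map_smul, map_smul]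

end Corona

/-! ### From nearby homomorphisms to a trivial cohomology class -/

/-- Discarding the phase costs at most `|α|`; this turns almost projective maps with small phases
into almost multiplicative ones. -/
theorem norm_sub_le_of_norm_smul_le {A : Type*} [CStarAlgebra A] {x y : A} (α : ℝ) {ε : ℝ}
    (hy : ‖y‖ ≤ 1) (h : ‖x - (Circle.exp α : ℂ) • y‖ ≤ ε) : ‖y - x‖ ≤ ε + |α| := by
  have e : y - x = -(x - (Circle.exp α : ℂ) • y) - ((Circle.exp α : ℂ) - 1) • y := by
    rw [sub_smul, one_smul]; abel
  rw [e]
  refine (norm_sub_le _ _).trans (add_le_add (by rwa [norm_neg]) ?_)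
  rw [norm_smul]
  exact (mul_le_of_le_one_right (norm_nonneg _) hy).trans (norm_circle_exp_sub_one_le α)

/-- If almost `σ_θ`-projective representations, for `θ → 0` and with errors `o(θ)`, are close to
homomorphisms, then `σ` is a coboundary. -/
theorem mem_twoCoboundaries_of_tendsto_hom {Γ : Type*} [Group Γ] (σ : twoCocycles Γ ℝ)
    (θ : ℕ → ℝ) (hθ_pos : ∀ n, 0 < θ n) (hθ_lim : Tendsto θ atTop (𝓝 0)) (r : ℕ → ℕ+)
    (ρ : ∀ n, Γ → unitary (Matrix (Fin (r n)) (Fin (r n)) ℂ)) (η : ℕ → ℝ)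
    (hη : Tendsto η atTop (𝓝 0))
    (hρ : ∀ s t, ∀ᶠ n in atTop, ‖(ρ n s * ρ n t : Matrix (Fin (r n)) (Fin (r n)) ℂ) -
      (Circle.exp (2 * Real.pi * θ n * σ.1 s t) : ℂ) •
        (ρ n (s * t) : Matrix (Fin (r n)) (Fin (r n)) ℂ)‖ ≤ θ n * η n)
    (π : ∀ n, Γ →* unitary (Matrix (Fin (r n)) (Fin (r n)) ℂ))
    (hπ : ∀ s, Tendsto (fun n => ‖(ρ n s : Matrix (Fin (r n)) (Fin (r n)) ℂ) - π n s‖) atTop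
      (𝓝 0)) :
    σ ∈ twoCoboundaries Γ ℝ := by
  let g : ∀ n, Γ → unitary (Matrix (Fin (r n)) (Fin (r n)) ℂ) := fun n s => ρ n s * (π n s)⁻¹
  have hgρ : ∀ n s, g n s * π n s = ρ n s := fun n s => inv_mul_cancel_right _ _
  have hg : ∀ s, ∀ᶠ n in atTop, ‖(g n s - 1 : Matrix (Fin (r n)) (Fin (r n)) ℂ)‖ ≤ 1 / 4 :=
    fun s => by
    filter_upwards [(hπ s).eventually_le_const (show (0 : ℝ) < 1 / 4 by norm_num)] with n hn
    rw [Unitary.norm_sub_eq] at hn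
    exact hn
  refine mem_twoCoboundaries_of_tendsto σ
    (fun n s => traceArg (g n s) / (2 * Real.pi * θ n * (r n : ℕ))) fun s t => ?_
  have hα : Tendsto (fun n => |2 * Real.pi * θ n * σ.1 s t|) atTop (𝓝 0) := by
    simpa using ((hθ_lim.const_mul (2 * Real.pi)).mul_const (σ.1 s t)).abs
  have hε : Tendsto (fun n => θ n * η n) atTop (𝓝 0) := by simpa using hθ_lim.mul hη
  rw [tendsto_iff_norm_sub_tendsto_zero]
  refine squeeze_zero' (Eventually.of_forall fun n => norm_nonneg _) ?_ hη
  filter_upwards [hg s, hg t, hg (s * t), hρ s t,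
    hα.eventually_le_const (show (0 : ℝ) < 1 / 4 by norm_num),
    hε.eventually_le_const (show (0 : ℝ) < 1 / 4 by norm_num)] with n h1 h2 h3 h4 h5 h6
  have key := abs_traceArg_add_sub_le (p := π n s) (q := π n t) h1 h2 h3 h5 h6 (by
    rw [← map_mul, hgρ, hgρ, hgρ]
    exact h4)
  have hr : (0 : ℝ) < (r n : ℕ) := by exact_mod_cast (r n).pos
  have hd : 0 < 2 * Real.pi * θ n * (r n : ℕ) :=
    mul_pos (mul_pos Real.two_pi_pos (hθ_pos n)) hr
  have e : traceArg (g n s) / (2 * Real.pi * θ n * (r n : ℕ)) -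
      traceArg (g n (s * t)) / (2 * Real.pi * θ n * (r n : ℕ)) +
      traceArg (g n t) / (2 * Real.pi * θ n * (r n : ℕ)) - σ.1 s t =
      (traceArg (g n s) + traceArg (g n t) - traceArg (g n (s * t)) -
        (r n : ℕ) * (2 * Real.pi * θ n * σ.1 s t)) / (2 * Real.pi * θ n * (r n : ℕ)) := by
    have := (hθ_pos n).ne'
    field_simp
    ring
  rw [Fintype.card_fin] at key
  rw [e, Real.norm_eq_abs, abs_div, abs_of_pos hd, div_le_iff₀ hd]
  refine key.trans ?_
  have hη0 : 0 ≤ η n :=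
    nonneg_of_mul_nonneg_right ((norm_nonneg _).trans h4) (hθ_pos n)
  -- After division the error `r · 2θη` becomes `η/π ≤ η`: both the size and θ cancel.
  nlinarith [Real.pi_gt_three, mul_nonneg (mul_nonneg hr.le (hθ_pos n).le) hη0]

end

theorem theorem1p4 {Γ : Type*} [Group Γ] [Countable Γ]
    (σ : twoCocycles Γ ℝ) (hσ : IsNormalizedCocycle σ) (hσ0 : SecondCohomology.mk σ ≠ 0)
    (θ : ℕ → ℝ) (hθ_anti : Antitone θ) (hθ_pos : ∀ n, 0 < θ n)
    (hθ_lim : Tendsto θ atTop (𝓝 0))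
    (hMF : ∀ n, HasNonzeroMFQuotient (TwistedGroupCStarAlgebra (expCocycle σ hσ (θ n)))) :
    ¬ MatriciallyStable Γ := by
  intro hst
  refine hσ0 ((QuotientAddGroup.eq_zero_iff σ).2 ?_)
  -- An enumeration exhausts Γ by finite sets, so each pair (s,t) is controlled for all large `n`.
  obtain ⟨f, hf⟩ := exists_injective_nat Γ
  have hfin : ∀ n, {s | f s < n}.Finite := fun n =>
    Set.Finite.preimage hf.injOn (Set.finite_Iio n)
  have hη : Tendsto (fun n : ℕ => 1 / ((n : ℝ) + 1)) atTop (𝓝 0) :=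
    tendsto_one_div_add_atTop_nhds_zero_nat
  -- The tolerance `θ n / (n + 1)` is o(θ_n), so it still tends to 0 after division by θ_n.
  choose r ρ hρ1 hρ using fun n => exists_almost_projective_of_hasNonzeroMFQuotient _ (hMF n)
    (hfin n).toFinset (mul_pos (hθ_pos n) (Nat.one_div_pos_of_nat (n := n)))
  have hρ' : ∀ s t, ∀ᶠ n in atTop, ‖(ρ n s * ρ n t : Matrix (Fin (r n)) (Fin (r n)) ℂ) -
      (Circle.exp (2 * Real.pi * θ n * σ.1 s t) : ℂ) •
        (ρ n (s * t) : Matrix (Fin (r n)) (Fin (r n)) ℂ)‖ ≤ θ n * (1 / ((n : ℝ) + 1)) := by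
    intro s t
    filter_upwards [eventually_gt_atTop (f s), eventually_gt_atTop (f t)] with n h1 h2
    exact hρ n s (by simpa using h1) t (by simpa using h2)
  obtain ⟨π, hπ⟩ := hst r ρ hρ1 fun s t => by
    refine squeeze_zero' (Eventually.of_forall fun n => norm_nonneg _)
      ((hρ' s t).mono fun n hn => norm_sub_le_of_norm_smul_le _
        ((CStarRing.norm_of_mem_unitary (ρ n (s * t)).2).le) hn) ?_
    simpa using (hθ_lim.mul hη).add
      ((hθ_lim.const_mul (2 * Real.pi)).mul_const (σ.1 s t)).abs
  exact mem_twoCoboundaries_of_tendsto_hom σ θ hθ_pos hθ_lim r ρ _ hη hρ' π hπ
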